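/- **Theorem (Universal approximation with CDEs).** Let $\tau<T$ be real and let $v,u\in\mathbb N$. Let $\mathcal V^1([\tau,T];\mathbb R^v)$ be the space of continuous paths $\widehat X\colon[\tau,T]\to\mathbb R^v$ of bounded variation, with the norm $\|\widehat X\|_{\mathcal V}=\|\widehat X\|_\infty+|\widehat X|_{BV}$, where $|\widehat X|_{BV}$ is the total variation of $\widehat X$ over $[\tau,T]$. For such a path write $X_t=(\widehat X_t,t)\in\mathbb R^{v+1}$ for the time-augmented path. For $w\in\mathbb N$, let $f\colon\mathbb R^w\to\mathbb R^{w\times(v+1)}$ and $\zeta\colon\mathbb R^{v+1}\to\mathbb R^w$ be continuous. Call the pair $(f,\zeta)$ *admissible* if for every $\widehat X\in\mathcal V^1([\tau,T];\mathbb R^v)$ the controlled differential equation $$z_t=z_\tau+\int_\tau^t f(z_s)\,\mathrm dX_s\quad\text{for } t\in(\tau,T],\qquad z_\tau=\zeta(X_\tau),$$ (with a Riemann--Stieltjes integral) has a continuous solution $z^{f,\zeta,X}$ on $[\tau,T]$ and this solution is unique, in the sense that for every $\sigma\in(\tau,T]$ every continuous solution of the same equation on $[\tau,\sigma]$ agrees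 with it on $[\tau,\sigma]$. Let $K\subseteq\mathcal V^1([\tau,T];\mathbb R^v)$ be compact, and give $C(K;\mathbb R^u)$ the topology of uniform convergence. Then $$\bigcup_{w\in\mathbb N}\left\{K\ni\widehat X\mapsto\ell\big(z^{f,\zeta,X}_T\big)\;:\;(f,\zeta)\text{ admissible with hidden dimension } w,\ \ell\colon\mathbb R^w\to\mathbb R^u\text{ linear}\right\}$$ is a dense subset of $C(K;\mathbb R^u)$; that is, all of these maps are continuous on $K$, and they are dense. -/

import Mathlib

/-- A function on a linear order has variation subadditive under addition. -/
theorem eVariationOn_add_le' {α : Type*} [LinearOrder α] {E : Type*} [NormedAddCommGroup E]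
    (f g : α → E) (s : Set α) :
    eVariationOn (f + g) s ≤ eVariationOn f s + eVariationOn g s := by
  apply iSup_le _
  rintro ⟨n, ⟨u, hu, us⟩⟩
  calc
    ∑ i ∈ Finset.range n, edist ((f + g) (u (i + 1))) ((f + g) (u i)) ≤
        ∑ i ∈ Finset.range n, (edist (f (u (i + 1))) (f (u i)) +
          edist (g (u (i + 1))) (g (u i))) :=
      Finset.sum_le_sum fun i _ => edist_add_add_le _ _ _ _
    _ = ∑ i ∈ Finset.range n, edist (f (u (i + 1))) (f (u i)) +
        ∑ i ∈ Finset.range n, edist (g (u (i + 1))) (g (u i)) := Finset.sum_add_distrib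
    _ ≤ eVariationOn f s + eVariationOn g s :=
      add_le_add (eVariationOn.sum_le hu us) (eVariationOn.sum_le hu us)

theorem eVariationOn_smul_eq' {α : Type*} [LinearOrder α] {E : Type*} [NormedAddCommGroup E]
    [NormedSpace ℝ E] (c : ℝ) (f : α → E) (s : Set α) :
    eVariationOn (c • f) s = ‖c‖ₑ * eVariationOn f s := by
  unfold eVariationOn
  rw [ENNReal.mul_iSup]
  refine iSup_congr fun p => ?_
  rw [Finset.mul_sum]
  refine Finset.sum_congr rfl fun i _ => ?_
  simp only [Pi.smul_apply, edist_smul₀]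
  rfl

/-- The linear subspace of the continuous paths `[τ, T] → ℝᵛ` that have bounded variation. -/
def bvSubmodule (τ T : ℝ) (v : ℕ) :
    Submodule ℝ C(Set.Icc τ T, EuclideanSpace ℝ (Fin v)) where
  carrier := {X | BoundedVariationOn X Set.univ}
  zero_mem' := by
    have h : eVariationOn (fun _ : Set.Icc τ T => (0 : EuclideanSpace ℝ (Fin v))) Set.univ = 0 :=
      eVariationOn.constant_on (by rintro _ ⟨_, _, rfl⟩ _ ⟨_, _, rfl⟩; rfl)
    change eVariationOn (fun _ : Set.Icc τ T => (0 : EuclideanSpace ℝ (Fin v))) Set.univ ≠ ⊤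
    rw [h]
    exact ENNReal.zero_ne_top
  add_mem' := by
    intro X Y hX hY
    exact ne_top_of_le_ne_top (ENNReal.add_ne_top.2 ⟨hX, hY⟩) (eVariationOn_add_le' X Y _)
  smul_mem' := by
    intro c X hX
    change eVariationOn (c • (X : Set.Icc τ T → EuclideanSpace ℝ (Fin v))) Set.univ ≠ ⊤
    rw [eVariationOn_smul_eq']
    exact ENNReal.mul_ne_top enorm_ne_top hX

/-- The space `𝒱¹([τ, T]; ℝᵛ)` of continuous paths of bounded variation. It is a type of its own
because its norm is not the one inherited from the continuous functions. -/
def BVPath (τ T : ℝ) (v : ℕ) : Type := bvSubmodule τ T v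

namespace BVPath

noncomputable instance (τ T : ℝ) (v : ℕ) : AddCommGroup (BVPath τ T v) :=
  inferInstanceAs (AddCommGroup (bvSubmodule τ T v))

noncomputable instance (τ T : ℝ) (v : ℕ) : Module ℝ (BVPath τ T v) :=
  inferInstanceAs (Module ℝ (bvSubmodule τ T v))

/-- The underlying continuous map of a path. -/
def toContinuousMap {τ T : ℝ} {v : ℕ} (X : BVPath τ T v) :
    C(Set.Icc τ T, EuclideanSpace ℝ (Fin v)) := X.1

/-- The total variation of a path over `[τ, T]`, as an extended nonnegative real. -/
noncomputable def eVar {τ T : ℝ} {v : ℕ} (X : BVPath τ T v) : ENNReal :=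
  eVariationOn X.toContinuousMap Set.univ

theorem eVar_ne_top {τ T : ℝ} {v : ℕ} (X : BVPath τ T v) : X.eVar ≠ ⊤ := X.2

/-- The norm `‖X‖_∞ + |X|_BV`. -/
noncomputable instance (τ T : ℝ) (v : ℕ) : Norm (BVPath τ T v) :=
  ⟨fun X => ‖X.toContinuousMap‖ + X.eVar.toReal⟩

theorem norm_def {τ T : ℝ} {v : ℕ} (X : BVPath τ T v) :
    ‖X‖ = ‖X.toContinuousMap‖ + X.eVar.toReal := rfl

theorem eVar_add_le {τ T : ℝ} {v : ℕ} (X Y : BVPath τ T v) :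
    (X + Y).eVar ≤ X.eVar + Y.eVar :=
  eVariationOn_add_le' (X.toContinuousMap : Set.Icc τ T → EuclideanSpace ℝ (Fin v))
    Y.toContinuousMap Set.univ

theorem eVar_smul {τ T : ℝ} {v : ℕ} (c : ℝ) (X : BVPath τ T v) :
    (c • X).eVar = ‖c‖ₑ * X.eVar :=
  eVariationOn_smul_eq' c (X.toContinuousMap : Set.Icc τ T → EuclideanSpace ℝ (Fin v)) Set.univ

theorem normCore (τ T : ℝ) (v : ℕ) : NormedSpace.Core ℝ (BVPath τ T v) where
  norm_nonneg X := by
    rw [norm_def]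
    positivity
  norm_smul c X := by
    have h : (c • X).toContinuousMap = c • X.toContinuousMap := rfl
    rw [norm_def, norm_def, h, norm_smul, eVar_smul, ENNReal.toReal_mul, toReal_enorm, mul_add]
  norm_triangle X Y := by
    have h : (X + Y).toContinuousMap = X.toContinuousMap + Y.toContinuousMap := rfl
    have h1 := norm_add_le X.toContinuousMap Y.toContinuousMap
    have h2 := ENNReal.toReal_mono (ENNReal.add_ne_top.2 ⟨X.eVar_ne_top, Y.eVar_ne_top⟩)
      (eVar_add_le X Y)
    rw [ENNReal.toReal_add X.eVar_ne_top Y.eVar_ne_top] at h2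
    rw [norm_def, norm_def, norm_def, h]
    linarith
  norm_eq_zero_iff X := by
    constructor
    · intro h
      rw [norm_def] at h
      have h1 : (0 : ℝ) ≤ X.eVar.toReal := ENNReal.toReal_nonneg
      have h2 : ‖X.toContinuousMap‖ = 0 :=
        le_antisymm (by linarith) (norm_nonneg _)
      exact Subtype.ext (norm_eq_zero.1 h2)
    · rintro rfl
      have h : (0 : BVPath τ T v).eVar = 0 := by
        simpa using eVar_smul 0 (0 : BVPath τ T v)
      have h' : (0 : BVPath τ T v).toContinuousMap = 0 := rfl
      rw [norm_def, h, h']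
      simp

noncomputable instance (τ T : ℝ) (v : ℕ) : NormedAddCommGroup (BVPath τ T v) :=
  NormedAddCommGroup.ofCore (normCore τ T v)

noncomputable instance (τ T : ℝ) (v : ℕ) : NormedSpace ℝ (BVPath τ T v) :=
  NormedSpace.ofCore (normCore τ T v)

/-- The time-augmented path `X_t = (X̂_t, t) ∈ ℝᵛ⁺¹`, for `t ∈ [τ, T]`. (Outside `[τ, T]` the
component `X̂` is extended by its endpoint values, which plays no role below.) -/
noncomputable def augment {τ T : ℝ} (h : τ ≤ T) {v : ℕ} (X : BVPath τ T v) (t : ℝ) :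
    EuclideanSpace ℝ (Fin (v + 1)) :=
  WithLp.toLp 2 (Fin.snoc (α := fun _ => ℝ) (Set.IccExtend h X.toContinuousMap t).ofLp t)

end BVPath

/-- `I` is the Riemann–Stieltjes integral `∫ₐᵇ A(s) dX(s)`, i.e. the limit of the tagged
Riemann–Stieltjes sums as the mesh of the partition tends to zero. Here `A` is matrix-valued, `X` is
vector-valued, and `A(s) dX(s)` is a matrix-vector product. -/
def HasRSIntegral {w d : ℕ} (A : ℝ → Matrix (Fin w) (Fin d) ℝ) (X : ℝ → EuclideanSpace ℝ (Fin d))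
    (a b : ℝ) (I : EuclideanSpace ℝ (Fin w)) : Prop :=
  ∀ ε > 0, ∃ δ > 0, ∀ (n : ℕ) (p ξ : ℕ → ℝ), p 0 = a → p n = b →
    (∀ i < n, p i ≤ ξ i ∧ ξ i ≤ p (i + 1) ∧ p (i + 1) - p i < δ) →
    ‖∑ i ∈ Finset.range n,
      WithLp.toLp 2 ((A (ξ i)).mulVec (X (p (i + 1)) - X (p i)).ofLp) - I‖ < ε

/-- `z` is continuous and solves `z_t = ζ₀ + ∫_τ^t f(z_s) dX_s` on `[τ, σ]`. -/
def IsCDESolution {w d : ℕ} (f : EuclideanSpace ℝ (Fin w) → Matrix (Fin w) (Fin d) ℝ)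
    (X : ℝ → EuclideanSpace ℝ (Fin d)) (ζ₀ : EuclideanSpace ℝ (Fin w)) (τ σ : ℝ)
    (z : ℝ → EuclideanSpace ℝ (Fin w)) : Prop :=
  ContinuousOn z (Set.Icc τ σ) ∧ z τ = ζ₀ ∧
    ∀ t ∈ Set.Ioc τ σ, HasRSIntegral (fun s => f (z s)) X τ t (z t - z τ)

/-- `z` is the unique solution of the CDE on `[τ, T]`: it is a solution on `[τ, T]`, and on every
interval `[τ, σ]` with `τ < σ ≤ T` there is no other solution. -/
def IsUniqueCDESolution {w d : ℕ} (f : EuclideanSpace ℝ (Fin w) → Matrix (Fin w) (Fin d) ℝ)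
    (X : ℝ → EuclideanSpace ℝ (Fin d)) (ζ₀ : EuclideanSpace ℝ (Fin w)) (τ T : ℝ)
    (z : ℝ → EuclideanSpace ℝ (Fin w)) : Prop :=
  IsCDESolution f X ζ₀ τ T z ∧
    ∀ σ ∈ Set.Ioc τ T, ∀ y, IsCDESolution f X ζ₀ τ σ y → Set.EqOn y z (Set.Icc τ σ)

/-- The functions `K → ℝᵘ` of the form `X̂ ↦ ℓ(z_T)`, where `z` is the unique solution of the CDE
with continuous vector field `f`, driven by the time-augmented path `X`, and started at `ζ(X_τ)`.
The unique solution is required to exist for every driving path of bounded variation. -/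
def cdeMaps {τ T : ℝ} (h : τ ≤ T) {v : ℕ} (u : ℕ) (K : Set (BVPath τ T v)) :
    Set (K → EuclideanSpace ℝ (Fin u)) :=
  {Φ | ∃ (w : ℕ) (f : EuclideanSpace ℝ (Fin w) → Matrix (Fin w) (Fin (v + 1)) ℝ)
      (ζ : EuclideanSpace ℝ (Fin (v + 1)) → EuclideanSpace ℝ (Fin w))
      (ℓ : EuclideanSpace ℝ (Fin w) →ₗ[ℝ] EuclideanSpace ℝ (Fin u))
      (z : BVPath τ T v → ℝ → EuclideanSpace ℝ (Fin w)),
    Continuous f ∧ Continuous ζ ∧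
    (∀ X : BVPath τ T v, IsUniqueCDESolution f (X.augment h) (ζ (X.augment h τ)) τ T (z X)) ∧
    Φ = fun X : K => ℓ (z X T)}

/-! Continuity needs no Lipschitz condition on `f`: uniqueness alone yields continuous dependence on
the driving path (`tendsto_of_unique_solution`). Suppose the driving paths converge in variation,
but along an ultrafilter the terminal values stay at distance at least `ε` from that of the limit
solution `z`. Stop each solution when its distance to `z` first reaches `ε`. The stopped solutions
stay in a compact ball, where the vector field is bounded, so their increments are controlled by the
variation of the limit path plus a vanishing error. As in Arzelà–Ascoli, they converge uniformly to
some `y`, which solves the limit equation before the limit `s` of the stopping times. Uniqueness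
gives `y = z` up to `s`, whereas the distance at the stopping times is exactly `ε`.

Density is Stone–Weierstrass. Time is a coordinate of `X`, so `dt` is one of the driving
differentials, and for continuous `g` the functional `exp (∫ g (X_s) ds)` is a coordinate of the
solution of the triangular system `dx = dX`, `dq = q g(x) dt`. This system has unique solutions
although `g` is only continuous: `x = X` is forced, and the equation for `q` is then scalar and
linear (`isUniqueCDESolution_expSolution`). Since `exp` turns sums of `g` into products, these
functionals form a monoid, so their linear span is an algebra. It separates `X` from `Y` by the
choice `g(x, t) = ⟨X_t - Y_t, (x, t)⟩`. Stacking finitely many exponentials in one system realises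
every linear combination. -/

open Set Filter Topology

/-! ### Tagged partitions and the filter of partitions of small mesh -/

/-- `P = (n, p, ξ)` is a tagged partition of `[a, b]` of mesh less than `δ`. -/
def IsTaggedPartition (a b δ : ℝ) (P : ℕ × (ℕ → ℝ) × (ℕ → ℝ)) : Prop :=
  P.2.1 0 = a ∧ P.2.1 P.1 = b ∧
    ∀ i < P.1, P.2.1 i ≤ P.2.2 i ∧ P.2.2 i ≤ P.2.1 (i + 1) ∧ P.2.1 (i + 1) - P.2.1 i < δ

namespace IsTaggedPartition

variable {a b δ : ℝ} {P : ℕ × (ℕ → ℝ) × (ℕ → ℝ)}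

theorem monotoneOn (h : IsTaggedPartition a b δ P) : MonotoneOn P.2.1 (Icc 0 P.1) := by
  have key : ∀ j, ∀ i ≤ j, j ≤ P.1 → P.2.1 i ≤ P.2.1 j := by
    intro j
    induction j with
    | zero =>
      intro i hi _
      rw [Nat.le_zero.1 hi]
    | succ k ih =>
      intro i hi hk
      rcases Nat.le_succ_iff.1 hi with h1 | rfl
      · exact (ih i h1 (by omega)).trans ((h.2.2 k (by omega)).1.trans (h.2.2 k (by omega)).2.1)
      · exact le_rfl
  exact fun i _ j hj hij => key j i hij hj.2

theorem point_mem (h : IsTaggedPartition a b δ P) {i : ℕ} (hi : i ≤ P.1) :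
    P.2.1 i ∈ Icc a b := by
  constructor
  · rw [← h.1]
    exact h.monotoneOn ⟨le_rfl, Nat.zero_le _⟩ ⟨Nat.zero_le _, hi⟩ (Nat.zero_le _)
  · rw [← h.2.1]
    exact h.monotoneOn ⟨Nat.zero_le _, hi⟩ ⟨Nat.zero_le _, le_rfl⟩ hi

theorem tag_mem (h : IsTaggedPartition a b δ P) {i : ℕ} (hi : i < P.1) :
    P.2.2 i ∈ Icc a b :=
  ⟨(h.point_mem hi.le).1.trans (h.2.2 i hi).1, (h.2.2 i hi).2.1.trans (h.point_mem hi).2⟩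

end IsTaggedPartition

/-- The filter of tagged partitions of `[a, b]` whose mesh tends to zero. -/
def rsFilter (a b : ℝ) : Filter (ℕ × (ℕ → ℝ) × (ℕ → ℝ)) :=
  ⨅ δ ∈ Ioi (0 : ℝ), 𝓟 {P | IsTaggedPartition a b δ P}

theorem rsFilter_hasBasis (a b : ℝ) :
    (rsFilter a b).HasBasis (fun δ : ℝ => 0 < δ) fun δ => {P | IsTaggedPartition a b δ P} := by
  refine hasBasis_biInf_principal' (s := fun δ => {P | IsTaggedPartition a b δ P}) ?_
    ⟨1, mem_Ioi.2 one_pos⟩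
  intro δ hδ δ' hδ'
  exact ⟨min δ δ', mem_Ioi.2 (lt_min hδ hδ'),
    fun P hP => ⟨hP.1, hP.2.1, fun i hi => ⟨(hP.2.2 i hi).1, (hP.2.2 i hi).2.1,
      (hP.2.2 i hi).2.2.trans_le (min_le_left _ _)⟩⟩,
    fun P hP => ⟨hP.1, hP.2.1, fun i hi => ⟨(hP.2.2 i hi).1, (hP.2.2 i hi).2.1,
      (hP.2.2 i hi).2.2.trans_le (min_le_right _ _)⟩⟩⟩

theorem eventually_isTaggedPartition (a b : ℝ) {δ : ℝ} (hδ : 0 < δ) :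
    ∀ᶠ P in rsFilter a b, IsTaggedPartition a b δ P :=
  (rsFilter_hasBasis a b).mem_of_mem hδ

/-- The equidistant partition of `[a, b]` into `n` pieces followed by that of `[b, c]`. -/
noncomputable def gluedPartition (a b c : ℝ) (n i : ℕ) : ℝ :=
  a + (b - a) * (min i n : ℕ) / n + (c - b) * (i - n : ℕ) / n

/-- A single sequence of points serves both intervals, so the sum over `[a, c]` minus the sum over
`[a, b]` is exactly the sum over the last `n` pieces. -/
theorem gluedPartition_isTaggedPartition {a b c δ : ℝ} (hab : a ≤ b) (hbc : b ≤ c) (hδ : 0 < δ) :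
    ∃ n : ℕ,
      IsTaggedPartition a b δ (n, gluedPartition a b c n, gluedPartition a b c n) ∧
      IsTaggedPartition a c δ (n + n, gluedPartition a b c n, gluedPartition a b c n) := by
  obtain ⟨n, hn⟩ := exists_nat_gt ((c - a) / δ)
  have hn0 : (0 : ℝ) < n := lt_of_le_of_lt (by have := sub_nonneg.2 (hab.trans hbc); positivity) hn
  rw [div_lt_iff₀ hδ] at hn
  have hstep : ∀ i : ℕ, gluedPartition a b c n i ≤ gluedPartition a b c n (i + 1) ∧
      gluedPartition a b c n (i + 1) - gluedPartition a b c n i < δ := by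
    intro i
    rcases lt_or_ge i n with h | h
    · have e : gluedPartition a b c n (i + 1) - gluedPartition a b c n i = (b - a) / n := by
        simp only [gluedPartition, min_eq_left h.le, min_eq_left (Nat.succ_le_of_lt h),
          Nat.sub_eq_zero_of_le h.le, Nat.sub_eq_zero_of_le (Nat.succ_le_of_lt h)]
        push_cast
        ring
      refine ⟨sub_nonneg.1 (e ▸ div_nonneg (sub_nonneg.2 hab) hn0.le), ?_⟩
      rw [e, div_lt_iff₀ hn0]
      nlinarith
    · have e : gluedPartition a b c n (i + 1) - gluedPartition a b c n i = (c - b) / n := by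
        simp only [gluedPartition, min_eq_right h, min_eq_right (h.trans i.le_succ),
          Nat.succ_sub h]
        push_cast
        ring
      refine ⟨sub_nonneg.1 (e ▸ div_nonneg (sub_nonneg.2 hbc) hn0.le), ?_⟩
      rw [e, div_lt_iff₀ hn0]
      nlinarith
  refine ⟨n, ⟨?_, ?_, fun i _ => ⟨le_rfl, hstep i⟩⟩, ⟨?_, ?_, fun i _ => ⟨le_rfl, hstep i⟩⟩⟩
  · simp [gluedPartition]
  · simp [gluedPartition, hn0.ne']
  · simp [gluedPartition]
  · simp [gluedPartition, hn0.ne']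

/-- This makes Riemann–Stieltjes integrals unique as limits. -/
theorem rsFilter_neBot {a b : ℝ} (hab : a ≤ b) : (rsFilter a b).NeBot := by
  rw [(rsFilter_hasBasis a b).neBot_iff]
  intro δ hδ
  obtain ⟨n, h, -⟩ := gluedPartition_isTaggedPartition hab le_rfl hδ
  exact ⟨_, h⟩

/-! ### Riemann–Stieltjes sums -/

theorem sum_dist_le_eVariationOn {E : Type*} [NormedAddCommGroup E] {X : ℝ → E}
    {s : Set ℝ} (hX : BoundedVariationOn X s) {m n : ℕ} {p : ℕ → ℝ} (hp : MonotoneOn p (Icc m n)) (hs : ∀ i ∈ Icc m n, p i ∈ s) :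
    ∑ i ∈ Finset.Ico m n, ‖X (p (i + 1)) - X (p i)‖ ≤ (eVariationOn X s).toReal := by
  rw [← ENNReal.ofReal_le_iff_le_toReal hX, ENNReal.ofReal_sum_of_nonneg fun _ _ => norm_nonneg _]
  simp_rw [← dist_eq_norm, ← edist_dist]
  exact eVariationOn.sum_le_of_monotoneOn_Icc hp hs

section Sums

variable {E F : Type*} [NormedAddCommGroup E] [NormedSpace ℝ E] [NormedAddCommGroup F]
  [NormedSpace ℝ F]

/-- The Riemann–Stieltjes sum of `A` against `X` over a tagged partition. -/
def rsSum (A : ℝ → E →L[ℝ] F) (X : ℝ → E) (P : ℕ × (ℕ → ℝ) × (ℕ → ℝ)) : F :=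
  ∑ i ∈ Finset.range P.1, A (P.2.2 i) (X (P.2.1 (i + 1)) - X (P.2.1 i))

theorem norm_sum_Ico_le {A : ℝ → E →L[ℝ] F} {X : ℝ → E} {s : Set ℝ}
    (hX : BoundedVariationOn X s) {m n : ℕ} {p ξ : ℕ → ℝ} (hp : MonotoneOn p (Icc m n))
    (hs : ∀ i ∈ Icc m n, p i ∈ s) {C : ℝ} (hC : 0 ≤ C) (hA : ∀ i, m ≤ i → i < n → ‖A (ξ i)‖ ≤ C) :
    ‖∑ i ∈ Finset.Ico m n, A (ξ i) (X (p (i + 1)) - X (p i))‖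
      ≤ C * (eVariationOn X s).toReal := by
  calc ‖∑ i ∈ Finset.Ico m n, A (ξ i) (X (p (i + 1)) - X (p i))‖
      ≤ ∑ i ∈ Finset.Ico m n, C * ‖X (p (i + 1)) - X (p i)‖ := by
        refine norm_sum_le_of_le _ fun i hi => ?_
        rw [Finset.mem_Ico] at hi
        exact (A (ξ i)).le_of_opNorm_le (hA i hi.1 hi.2) _
    _ ≤ C * (eVariationOn X s).toReal := by
        rw [← Finset.mul_sum]
        exact mul_le_mul_of_nonneg_left (sum_dist_le_eVariationOn hX hp hs) hC

theorem norm_rsSum_le {A : ℝ → E →L[ℝ] F} {X : ℝ → E} {a b δ : ℝ}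
    (hX : BoundedVariationOn X (Icc a b)) {P : ℕ × (ℕ → ℝ) × (ℕ → ℝ)}
    (hP : IsTaggedPartition a b δ P) {C : ℝ} (hC : 0 ≤ C) (hA : ∀ s ∈ Icc a b, ‖A s‖ ≤ C) :
    ‖rsSum A X P‖ ≤ C * (eVariationOn X (Icc a b)).toReal := by
  rw [rsSum, Finset.range_eq_Ico]
  exact norm_sum_Ico_le hX hP.monotoneOn (fun i hi => hP.point_mem hi.2) hC
    fun i _ hi => hA _ (hP.tag_mem hi)

theorem rsSum_sub_left (A B : ℝ → E →L[ℝ] F) (X : ℝ → E) (P : ℕ × (ℕ → ℝ) × (ℕ → ℝ)) :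
    rsSum (fun s => A s - B s) X P = rsSum A X P - rsSum B X P := by
  simp [rsSum, Finset.sum_sub_distrib]

theorem rsSum_sub_right (A : ℝ → E →L[ℝ] F) (X Y : ℝ → E) (P : ℕ × (ℕ → ℝ) × (ℕ → ℝ)) :
    rsSum A (fun t => X t - Y t) P = rsSum A X P - rsSum A Y P := by
  rw [rsSum, rsSum, rsSum, ← Finset.sum_sub_distrib]
  refine Finset.sum_congr rfl fun i _ => ?_
  rw [← map_sub]
  congr 1
  abel

/-- The increment of an indefinite Riemann–Stieltjes integral is bounded by the variation of the
integrator. -/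
theorem norm_sub_le_of_tendsto_rsSum {A : ℝ → E →L[ℝ] F} {X : ℝ → E} {a b c : ℝ} (hab : a ≤ b)
    (hbc : b ≤ c) {I J : F} (hI : Tendsto (rsSum A X) (rsFilter a b) (𝓝 I))
    (hJ : Tendsto (rsSum A X) (rsFilter a c) (𝓝 J)) (hX : BoundedVariationOn X (Icc b c)) {C : ℝ}
    (hC : 0 ≤ C) (hA : ∀ s ∈ Icc b c, ‖A s‖ ≤ C) :
    ‖J - I‖ ≤ C * (eVariationOn X (Icc b c)).toReal := by
  refine le_of_forall_pos_le_add fun ε hε => ?_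
  obtain ⟨δ₁, hδ₁, h₁⟩ := (rsFilter_hasBasis a b).eventually_iff.1
    (Metric.tendsto_nhds.1 hI (ε / 2) (half_pos hε))
  obtain ⟨δ₂, hδ₂, h₂⟩ := (rsFilter_hasBasis a c).eventually_iff.1
    (Metric.tendsto_nhds.1 hJ (ε / 2) (half_pos hε))
  -- On the glued partition both integrals are approximated at once, and the difference of the two
  -- sums involves only points and tags in `[b, c]`.
  obtain ⟨n, hP, hQ⟩ := gluedPartition_isTaggedPartition hab hbc (lt_min hδ₁ hδ₂)
  have k₁ := h₁ (x := (n, gluedPartition a b c n, gluedPartition a b c n))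
    ⟨hP.1, hP.2.1, fun i hi => ⟨(hP.2.2 i hi).1, (hP.2.2 i hi).2.1,
      (hP.2.2 i hi).2.2.trans_le (min_le_left _ _)⟩⟩
  have k₂ := h₂ (x := (n + n, gluedPartition a b c n, gluedPartition a b c n))
    ⟨hQ.1, hQ.2.1, fun i hi => ⟨(hQ.2.2 i hi).1, (hQ.2.2 i hi).2.1,
      (hQ.2.2 i hi).2.2.trans_le (min_le_right _ _)⟩⟩
  have hmono : MonotoneOn (gluedPartition a b c n) (Icc n (n + n)) :=
    hQ.monotoneOn.mono (Icc_subset_Icc_left (Nat.zero_le _))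
  have hmem : ∀ i ∈ Icc n (n + n), gluedPartition a b c n i ∈ Icc b c := by
    intro i hi
    refine ⟨?_, (hQ.point_mem hi.2).2⟩
    have h1 : gluedPartition a b c n n = b := hP.2.1
    calc b = gluedPartition a b c n n := h1.symm
      _ ≤ _ := hmono ⟨le_rfl, Nat.le_add_left _ _⟩ hi hi.1
  have hdiff := norm_sum_Ico_le (A := A) (ξ := gluedPartition a b c n) hX hmono hmem hC
    fun i h1 h2 => hA _ (hmem i ⟨h1, h2.le⟩)
  rw [Finset.sum_Ico_eq_sub _ (Nat.le_add_left n n)] at hdiff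
  rw [dist_eq_norm] at k₁ k₂
  change ‖rsSum A X (n + n, gluedPartition a b c n, gluedPartition a b c n) -
    rsSum A X (n, gluedPartition a b c n, gluedPartition a b c n)‖ ≤ _ at hdiff
  have e : J - I = (rsSum A X (n + n, gluedPartition a b c n, gluedPartition a b c n) -
      rsSum A X (n, gluedPartition a b c n, gluedPartition a b c n)) +
      (rsSum A X (n, gluedPartition a b c n, gluedPartition a b c n) - I) -
      (rsSum A X (n + n, gluedPartition a b c n, gluedPartition a b c n) - J) := by abel
  rw [e]
  refine (norm_sub_le _ _).trans ?_
  refine (add_le_add_left (norm_add_le _ _) _).trans ?_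
  linarith

/-- A function whose increments are approximated by `A ξ (X q - X p)` up to an error that is small
compared to `q - p` is an indefinite Riemann–Stieltjes integral. -/
theorem tendsto_rsSum_of_increment {A : ℝ → E →L[ℝ] F} {X : ℝ → E} {Z : ℝ → F} {a b : ℝ}
    (h : ∀ ε > 0, ∃ δ > 0, ∀ p ξ q, a ≤ p → p ≤ ξ → ξ ≤ q → q ≤ b → q - p < δ →
      ‖A ξ (X q - X p) - (Z q - Z p)‖ ≤ ε * (q - p)) :
    Tendsto (rsSum A X) (rsFilter a b) (𝓝 (Z b - Z a)) := by
  rw [Metric.tendsto_nhds]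
  intro ε hε
  -- The summand `1` keeps the denominator positive when `a = b`.
  have hη : 0 < ε / (2 * (|b - a| + 1)) := by positivity
  obtain ⟨δ, hδ, hh⟩ := h _ hη
  filter_upwards [eventually_isTaggedPartition a b hδ] with P hP
  have e : ∀ g : ℝ → F, g b - g a = ∑ i ∈ Finset.range P.1, (g (P.2.1 (i + 1)) - g (P.2.1 i)) := by
    intro g
    rw [Finset.sum_range_sub (fun i => g (P.2.1 i)), hP.1, hP.2.1]
  have e' : b - a = ∑ i ∈ Finset.range P.1, (P.2.1 (i + 1) - P.2.1 i) := by
    rw [Finset.sum_range_sub, hP.1, hP.2.1]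
  rw [dist_eq_norm, e, rsSum, ← Finset.sum_sub_distrib]
  calc _ ≤ ∑ i ∈ Finset.range P.1, ε / (2 * (|b - a| + 1)) * (P.2.1 (i + 1) - P.2.1 i) := by
        refine norm_sum_le_of_le _ fun i hi => ?_
        rw [Finset.mem_range] at hi
        obtain ⟨h1, h2, h3⟩ := hP.2.2 i hi
        exact hh _ _ _ (hP.point_mem hi.le).1 h1 h2 (hP.point_mem hi).2 h3
    _ = ε / (2 * (|b - a| + 1)) * (b - a) := by rw [← Finset.mul_sum, ← e']
    _ ≤ ε / (2 * (|b - a| + 1)) * (|b - a| + 1) :=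
        mul_le_mul_of_nonneg_left ((le_abs_self _).trans (by linarith)) hη.le
    _ = ε / 2 := by
        have : |b - a| + 1 ≠ 0 := by positivity
        field_simp
    _ < ε := half_lt_self hε

end Sums

/-! ### The matrix-valued case -/

/-- The linear map of Euclidean spaces given by a matrix. -/
noncomputable def matrixCLM (w d : ℕ) :
    Matrix (Fin w) (Fin d) ℝ →ₗ[ℝ] (EuclideanSpace ℝ (Fin d) →L[ℝ] EuclideanSpace ℝ (Fin w)) :=
  (LinearMap.toContinuousLinearMap.toLinearMap).comp Matrix.toEuclideanLin.toLinearMap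

theorem matrixCLM_apply {w d : ℕ} (M : Matrix (Fin w) (Fin d) ℝ) (x : EuclideanSpace ℝ (Fin d)) :
    matrixCLM w d M x = WithLp.toLp 2 (M.mulVec x.ofLp) := rfl

theorem continuous_matrixCLM (w d : ℕ) : Continuous (matrixCLM w d) :=
  LinearMap.continuous_of_finiteDimensional _

theorem hasRSIntegral_iff_tendsto {w d : ℕ} {A : ℝ → Matrix (Fin w) (Fin d) ℝ}
    {X : ℝ → EuclideanSpace ℝ (Fin d)} {a b : ℝ} {I : EuclideanSpace ℝ (Fin w)} :
    HasRSIntegral A X a b I ↔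
      Tendsto (rsSum (fun s => matrixCLM w d (A s)) X) (rsFilter a b) (𝓝 I) := by
  rw [((rsFilter_hasBasis a b).tendsto_iff Metric.nhds_basis_ball)]
  refine forall₂_congr fun ε _ => exists_congr fun δ => and_congr_right fun _ => ?_
  constructor
  · intro h P hP
    rw [mem_ball_iff_norm]
    exact h P.1 P.2.1 P.2.2 hP.1 hP.2.1 hP.2.2
  · intro h n p ξ h0 h1 h2
    have := h (n, p, ξ) ⟨h0, h1, h2⟩
    rw [mem_ball_iff_norm] at this
    exact this

/-! ### Stability of Riemann–Stieltjes integrals and of solutions -/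

/-- The level set `{D = ε}` is compact and nonempty, and `σ` is its least element. A value above `ε`
before `σ` would, by the intermediate value theorem, force an earlier point of the level set. -/
theorem exists_first_hitting {D : ℝ → ℝ} {a b ε : ℝ} (hab : a ≤ b) (hD : ContinuousOn D (Icc a b))
    (ha : D a < ε) (hb : ε ≤ D b) :
    ∃ σ ∈ Icc a b, D σ = ε ∧ ∀ t ∈ Icc a σ, D t ≤ ε := by
  have hc : IsCompact (Icc a b ∩ D ⁻¹' {ε}) :=
    isCompact_Icc.of_isClosed_subset (hD.preimage_isClosed_of_isClosed isClosed_Icc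
      isClosed_singleton) inter_subset_left
  obtain ⟨t, ht, hte⟩ := intermediate_value_Icc hab hD ⟨ha.le, hb⟩
  obtain ⟨σ, ⟨hσ, hσe⟩, hmin⟩ := hc.exists_isLeast ⟨t, ht, hte⟩
  refine ⟨σ, hσ, hσe, fun t ht => ?_⟩
  by_contra! hlt
  have htb : t ≤ b := ht.2.trans hσ.2
  obtain ⟨r, hr, hre⟩ := intermediate_value_Icc ht.1 (hD.mono (Icc_subset_Icc_right htb))
    ⟨ha.le, hlt.le⟩
  have h1 : σ ≤ r := hmin ⟨⟨hr.1, hr.2.trans htb⟩, hre⟩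
  have h2 : t = σ := le_antisymm ht.2 (h1.trans hr.2)
  rw [h2] at hlt
  exact hlt.ne' hσe

/-- This supplies the modulus of continuity `ω` for the stopped solutions: the variation of a
continuous path over a shrinking interval vanishes on either side of `s`. -/
theorem tendsto_eVariationOn_uIcc {E : Type*} [PseudoEMetricSpace E] {x : ℝ → E} {a b s : ℝ}
    (hx : BoundedVariationOn x (Icc a b)) (hc : ContinuousOn x (Icc a b)) (hs : s ∈ Icc a b) :
    Tendsto (fun t => (eVariationOn x (uIcc s t)).toReal) (𝓝[Icc a b] s) (𝓝 0) := by
  have h1 := hx.tendsto_eVariationOn_Icc_zero_left ((hc s hs).mono inter_subset_left)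
  have h2 := hx.tendsto_eVariationOn_Icc_zero_right s ((hc s hs).mono inter_subset_left)
  have h3 := h1.add h2
  rw [add_zero] at h3
  rw [← ENNReal.toReal_zero]
  refine (ENNReal.tendsto_toReal ENNReal.zero_ne_top).comp
    (tendsto_of_tendsto_of_tendsto_of_le_of_le' tendsto_const_nhds h3
      (Eventually.of_forall fun _ => zero_le) ?_)
  filter_upwards [self_mem_nhdsWithin] with t ht
  rcases le_total s t with h | h
  · rw [uIcc_of_le h, inter_eq_self_of_subset_right (Icc_subset_Icc hs.1 ht.2)]
    exact le_add_self
  · rw [uIcc_of_ge h, inter_eq_self_of_subset_right (Icc_subset_Icc ht.1 hs.2)]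
    exact le_self_add

/-! ### Families that are equicontinuous up to a vanishing error. -/

section AsymptoticEquicontinuity

variable {ι F : Type*} [NormedAddCommGroup F] {U : Filter ι} [U.NeBot] {S : Set ℝ}
  {ω : ℝ → ℝ → ℝ} {d : ι → ℝ} {Y : ι → ℝ → F} {y : ℝ → F}

theorem norm_sub_le_of_asymptotic (hd : Tendsto d U (𝓝 0))
    (hY : ∀ᶠ i in U, ∀ s ∈ S, ∀ t ∈ S, ‖Y i t - Y i s‖ ≤ ω s t + d i)
    (hy : ∀ t ∈ S, Tendsto (fun i => Y i t) U (𝓝 (y t))) :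
    ∀ s ∈ S, ∀ t ∈ S, ‖y t - y s‖ ≤ ω s t := by
  intro s hs t ht
  have h := tendsto_const_nhds (x := ω s t).add hd
  rw [add_zero] at h
  exact le_of_tendsto_of_tendsto ((hy t ht).sub (hy s hs)).norm h
    (hY.mono fun i hi => hi s hs t ht)

theorem continuousOn_of_asymptotic (hω : ∀ s ∈ S, Tendsto (ω s) (𝓝[S] s) (𝓝 0))
    (hd : Tendsto d U (𝓝 0))
    (hY : ∀ᶠ i in U, ∀ s ∈ S, ∀ t ∈ S, ‖Y i t - Y i s‖ ≤ ω s t + d i)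
    (hy : ∀ t ∈ S, Tendsto (fun i => Y i t) U (𝓝 (y t))) : ContinuousOn y S := by
  intro s hs
  rw [ContinuousWithinAt, tendsto_iff_norm_sub_tendsto_zero]
  refine squeeze_zero' (Eventually.of_forall fun _ => norm_nonneg _) ?_ (hω s hs)
  filter_upwards [self_mem_nhdsWithin] with t ht
  exact norm_sub_le_of_asymptotic hd hY hy s hs t ht

/-- The Arzelà–Ascoli argument: near each `s` the increments of `Y i` and `y` are small and `Y i s`
is close to `y s`; compactness passes to finitely many such neighbourhoods. -/
theorem tendstoUniformlyOn_of_asymptotic (hS : IsCompact S)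
    (hω : ∀ s ∈ S, Tendsto (ω s) (𝓝[S] s) (𝓝 0)) (hd : Tendsto d U (𝓝 0))
    (hY : ∀ᶠ i in U, ∀ s ∈ S, ∀ t ∈ S, ‖Y i t - Y i s‖ ≤ ω s t + d i)
    (hy : ∀ t ∈ S, Tendsto (fun i => Y i t) U (𝓝 (y t))) : TendstoUniformlyOn Y y U S := by
  rw [Metric.tendstoUniformlyOn_iff]
  intro ε hε
  have hε4 : 0 < ε / 4 := by positivity
  refine hS.induction_on (p := fun R => ∀ᶠ i in U, ∀ t ∈ R, dist (y t) (Y i t) < ε) (by simp)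
    (fun R R' h hR' => hR'.mono fun i hi t ht => hi t (h ht)) (fun R R' h h' => ?_) fun s hs => ?_
  · filter_upwards [h, h'] with i hi hi' t ht
    exact ht.elim (hi t) (hi' t)
  · refine ⟨_, inter_mem self_mem_nhdsWithin ((hω s hs).eventually (gt_mem_nhds hε4)), ?_⟩
    filter_upwards [hY, hd.eventually (gt_mem_nhds hε4),
      (Metric.tendsto_nhds.1 (hy s hs)) _ hε4] with i h1 h2 h3 t ht
    have k1 := h1 s hs t ht.1
    have k2 := norm_sub_le_of_asymptotic hd hY hy s hs t ht.1
    have k3 : ω s t < ε / 4 := ht.2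
    rw [dist_eq_norm] at h3 ⊢
    have e : y t - Y i t = (y t - y s) - (Y i s - y s) - (Y i t - Y i s) := by abel
    rw [e]
    refine (norm_sub_le _ _).trans_lt ((add_le_add_left (norm_sub_le _ _) _).trans_lt ?_)
    linarith

end AsymptoticEquicontinuity

theorem boundedVariationOn_of_sub {E : Type*} [NormedAddCommGroup E] {x x' : ℝ → E} {s : Set ℝ} 
    (hx : BoundedVariationOn x s) (hd : BoundedVariationOn (fun t => x' t - x t) s) :
    BoundedVariationOn x' s ∧
    (eVariationOn x' s).toReal ≤
      (eVariationOn x s).toReal + (eVariationOn (fun t => x' t - x t) s).toReal := by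
  have h := eVariationOn_add_le' x (fun t => x' t - x t) s
  have e : x + (fun t => x' t - x t) = x' := by
    ext t
    simp
  rw [e] at h
  have hf := ENNReal.add_ne_top.2 ⟨hx, hd⟩
  refine ⟨ne_top_of_le_ne_top hf h, ?_⟩
  rw [← ENNReal.toReal_add hx hd]
  exact ENNReal.toReal_mono hf h

section Stability

variable {ι E F : Type*} [NormedAddCommGroup E] [NormedSpace ℝ E] [NormedAddCommGroup F]
  [NormedSpace ℝ F]

/-- Riemann–Stieltjes integrals pass to limits that are uniform in the integrand and in variation
in the integrator. -/
theorem tendsto_rsSum_of_limit {U : Filter ι} [U.NeBot] {a b : ℝ} {x : ℝ → E} {x' : ι → ℝ → E}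
    {A : ℝ → E →L[ℝ] F} {A' : ι → ℝ → E →L[ℝ] F} {I : F} {I' : ι → F}
    (hx : BoundedVariationOn x (Icc a b))
    (hd : ∀ i, BoundedVariationOn (fun t => x' i t - x t) (Icc a b))
    (hd0 : Tendsto (fun i => (eVariationOn (fun t => x' i t - x t) (Icc a b)).toReal) U (𝓝 0))
    {C : ℝ} (hC : 0 ≤ C) (hA : ∀ᶠ i in U, ∀ s ∈ Icc a b, ‖A' i s‖ ≤ C)
    (hAA : TendstoUniformlyOn A' A U (Icc a b))
    (hI' : ∀ᶠ i in U, Tendsto (rsSum (A' i) (x' i)) (rsFilter a b) (𝓝 (I' i)))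
    (hI : Tendsto I' U (𝓝 I)) : Tendsto (rsSum A x) (rsFilter a b) (𝓝 I) := by
  rw [Metric.tendsto_nhds]
  intro ε hε
  set V := (eVariationOn x (Icc a b)).toReal with hV
  have hV0 : 0 ≤ V := ENNReal.toReal_nonneg
  -- These tolerances make each of the two comparison errors, bounded by `η * V` and `C * κ`, at
  -- most `ε / 4`; the `+ 1` covers `V = 0` and `C = 0`.
  have hη : 0 < ε / (4 * (V + 1)) := by positivity
  have hκ : 0 < ε / (4 * (C + 1)) := by positivity
  rw [Metric.tendstoUniformlyOn_iff] at hAA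
  -- One good index `i` is fixed first. Only then does the mesh tend to zero, and all sums are
  -- compared over the same partition.
  obtain ⟨i, h1, h2, h3, h4, h5⟩ := ((hAA _ hη).and ((hd0.eventually (gt_mem_nhds hκ)).and
    (hA.and (hI'.and (Metric.tendsto_nhds.1 hI (ε / 4) (by positivity)))))).exists
  filter_upwards [Metric.tendsto_nhds.1 h4 (ε / 4) (by positivity),
    eventually_isTaggedPartition a b one_pos] with P h6 hP
  have k1 : ‖rsSum (A' i) (x' i) P - rsSum (A' i) x P‖ ≤ ε / 4 := by
    rw [← rsSum_sub_right]
    refine (norm_rsSum_le (hd i) hP hC h3).trans ?_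
    refine (mul_le_mul_of_nonneg_left h2.le hC).trans ?_
    rw [mul_div_assoc', div_le_div_iff₀ (by positivity) (by positivity)]
    nlinarith
  have k2 : ‖rsSum A x P - rsSum (A' i) x P‖ ≤ ε / 4 := by
    rw [← rsSum_sub_left]
    refine (norm_rsSum_le hx hP hη.le fun s hs => ?_).trans ?_
    · rw [← dist_eq_norm]
      exact (h1 s hs).le
    · rw [← hV, div_mul_eq_mul_div, div_le_div_iff₀ (by positivity) (by positivity)]
      nlinarith
  rw [dist_eq_norm] at h5 h6 ⊢
  have e : rsSum A x P - I = (rsSum A x P - rsSum (A' i) x P) -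
      (rsSum (A' i) (x' i) P - rsSum (A' i) x P) + (rsSum (A' i) (x' i) P - I' i) + (I' i - I) := by
    abel
  rw [e]
  refine (norm_add_le _ _).trans_lt ?_
  have n1 := norm_add_le ((rsSum A x P - rsSum (A' i) x P) -
      (rsSum (A' i) (x' i) P - rsSum (A' i) x P)) (rsSum (A' i) (x' i) P - I' i)
  have n2 := norm_sub_le (rsSum A x P - rsSum (A' i) x P)
      (rsSum (A' i) (x' i) P - rsSum (A' i) x P)
  linarith

/-- `z` is continuous on `[a, b]` and `z t = z a + ∫ₐᵗ G (z s) dx s` there. -/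
def SolvesCDE (G : F → E →L[ℝ] F) (x : ℝ → E) (a b : ℝ) (z : ℝ → F) : Prop :=
  ContinuousOn z (Icc a b) ∧
    ∀ t ∈ Ioc a b, Tendsto (rsSum (fun s => G (z s)) x) (rsFilter a t) (𝓝 (z t - z a))

/-- The endpoint `t = a` can be included because every piece of a partition of `[a, a]` is
degenerate. -/
theorem SolvesCDE.tendsto {G : F → E →L[ℝ] F} {x : ℝ → E} {a b : ℝ} {z : ℝ → F}
    (h : SolvesCDE G x a b z) {t : ℝ} (ht : t ∈ Icc a b) :
    Tendsto (rsSum (fun s => G (z s)) x) (rsFilter a t) (𝓝 (z t - z a)) := by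
  rcases ht.1.eq_or_lt with rfl | h1
  · refine tendsto_rsSum_of_increment fun ε _ => ⟨1, one_pos, fun p ξ q h1 h2 h3 h4 _ => ?_⟩
    have e : p = q := le_antisymm (h2.trans h3) (h4.trans h1)
    simp [e]
  · exact h.2 t ⟨h1, ht.2⟩

theorem SolvesCDE.norm_sub_le {G : F → E →L[ℝ] F} {x : ℝ → E} {a b : ℝ} {z : ℝ → F}
    (h : SolvesCDE G x a b z) {s t : ℝ} (has : a ≤ s) (hst : s ≤ t) (htb : t ≤ b)
    (hx : BoundedVariationOn x (Icc s t)) {C : ℝ} (hC : 0 ≤ C)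
    (hG : ∀ r ∈ Icc s t, ‖G (z r)‖ ≤ C) :
    ‖z t - z s‖ ≤ C * (eVariationOn x (Icc s t)).toReal := by
  have := norm_sub_le_of_tendsto_rsSum has hst (h.tendsto ⟨has, hst.trans htb⟩)
    (h.tendsto ⟨has.trans hst, htb⟩) hx hC hG
  rwa [sub_sub_sub_cancel_right] at this

/-- A solution stopped at time `σ` has increments controlled by the variation of a nearby
driving path. -/
theorem SolvesCDE.norm_stopped_sub_le {G : F → E →L[ℝ] F} {x x' : ℝ → E} {a b σ : ℝ} {z : ℝ → F}
    (h : SolvesCDE G x' a b z) (hx : BoundedVariationOn x (Icc a b))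
    (hd : BoundedVariationOn (fun t => x' t - x t) (Icc a b)) {C : ℝ} (hC : 0 ≤ C)
    (hG : ∀ r ∈ Icc a σ, ‖G (z r)‖ ≤ C) {s t : ℝ} (hs : s ∈ Icc a b) (ht : t ∈ Icc a b) :
    ‖z (min t σ) - z (min s σ)‖ ≤ C * (eVariationOn x (uIcc s t)).toReal +
      C * (eVariationOn (fun t => x' t - x t) (Icc a b)).toReal := by
  wlog hst : s ≤ t generalizing s t
  · rw [norm_sub_rev, uIcc_comm]
    exact this ht hs (le_of_not_ge hst)
  rcases le_total σ s with h1 | h1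
  · rw [min_eq_right h1, min_eq_right (h1.trans hst), sub_self, norm_zero]
    positivity
  · rw [min_eq_left h1, uIcc_of_le hst]
    have hsub : Icc s (min t σ) ⊆ Icc a b := Icc_subset_Icc hs.1 ((min_le_left _ _).trans ht.2)
    obtain ⟨b1, b2⟩ := boundedVariationOn_of_sub (hx.mono hsub) (hd.mono hsub)
    refine (h.norm_sub_le hs.1 (le_min hst h1) ((min_le_left _ _).trans ht.2) b1 hC
      fun r hr => hG r ⟨hs.1.trans hr.1, hr.2.trans (min_le_right _ _)⟩).trans ?_
    rw [← mul_add]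
    refine mul_le_mul_of_nonneg_left (b2.trans (add_le_add ?_ ?_)) hC
    · exact ENNReal.toReal_mono (hx.mono (Icc_subset_Icc hs.1 ht.2))
        (eVariationOn.mono _ (Icc_subset_Icc_right (min_le_left _ _)))
    · exact ENNReal.toReal_mono hd (eVariationOn.mono _ hsub)

/-- Uniqueness of solutions implies their continuous dependence on the driving path. -/
theorem tendsto_of_unique_solution [ProperSpace F] {U : Ultrafilter ι} {G : F → E →L[ℝ] F}
    (hG : Continuous G) {a b : ℝ} (hab : a ≤ b) {x : ℝ → E} {x' : ι → ℝ → E} {z : ℝ → F}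
    {z' : ι → ℝ → F} (hx : BoundedVariationOn x (Icc a b)) (hxc : ContinuousOn x (Icc a b))
    (hd : ∀ i, BoundedVariationOn (fun t => x' i t - x t) (Icc a b))
    (hd0 : Tendsto (fun i => (eVariationOn (fun t => x' i t - x t) (Icc a b)).toReal) U (𝓝 0))
    (hz : ContinuousOn z (Icc a b)) (hz' : ∀ i, SolvesCDE G (x' i) a b (z' i))
    (huniq : ∀ σ ∈ Ioc a b, ∀ y, SolvesCDE G x a σ y → y a = z a → EqOn y z (Icc a σ))
    (h0 : Tendsto (fun i => z' i a) U (𝓝 (z a))) :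
    Tendsto (fun i => z' i b) U (𝓝 (z b)) := by
  rw [Metric.tendsto_nhds]
  intro ε hε
  by_contra hcon
  -- For an ultrafilter, failing to be eventually close means being eventually at distance at least
  -- `ε`.
  rw [← Ultrafilter.eventually_not] at hcon
  set D : ι → ℝ → ℝ := fun i t => dist (z' i t) (z t) with hDdef
  have hD : ∀ i, ContinuousOn (D i) (Icc a b) := fun i =>
    continuous_dist.comp_continuousOn ((hz' i).1.prodMk hz)
  have hex : ∀ i, ∃ σ ∈ Icc a b, D i a < ε → ε ≤ D i b →
      D i σ = ε ∧ ∀ t ∈ Icc a σ, D i t ≤ ε := by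
    intro i
    by_cases h : D i a < ε ∧ ε ≤ D i b
    · obtain ⟨σ, h1, h2⟩ := exists_first_hitting hab (hD i) h.1 h.2
      exact ⟨σ, h1, fun _ _ => h2⟩
    · exact ⟨a, left_mem_Icc.2 hab, fun h1 h2 => absurd ⟨h1, h2⟩ h⟩
  choose σ hσ hσ' using hex
  have hgood : ∀ᶠ i in U, D i (σ i) = ε ∧ ∀ t ∈ Icc a (σ i), D i t ≤ ε := by
    filter_upwards [hcon, Metric.tendsto_nhds.1 h0 ε hε] with i h1 h2
    exact hσ' i h2 (not_lt.1 h1)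
  obtain ⟨R, hR⟩ := (isCompact_Icc.image_of_continuousOn hz).isBounded.exists_norm_le
  have hball : IsCompact (Metric.closedBall (0 : F) (R + ε)) := isCompact_closedBall _ _
  obtain ⟨C₀, hC₀⟩ := (hball.image hG).isBounded.exists_norm_le
  set C := max C₀ 0
  have hC : 0 ≤ C := le_max_right _ _
  have hGC : ∀ p ∈ Metric.closedBall (0 : F) (R + ε), ‖G p‖ ≤ C := fun p hp =>
    (hC₀ _ (mem_image_of_mem _ hp)).trans (le_max_left _ _)
  have hbd : ∀ᶠ i in U, ∀ t ∈ Icc a (σ i), z' i t ∈ Metric.closedBall (0 : F) (R + ε) := by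
    filter_upwards [hgood] with i hi t ht
    have h1 := hi.2 t ht
    have h2 := hR _ (mem_image_of_mem z ⟨ht.1, ht.2.trans (hσ i).2⟩)
    rw [hDdef] at h1
    simp only [dist_eq_norm] at h1
    rw [mem_closedBall_zero_iff]
    have e : z' i t = z t + (z' i t - z t) := by abel
    rw [e]
    exact (norm_add_le _ _).trans (add_le_add h2 h1)
  set Y : ι → ℝ → F := fun i t => z' i (min t (σ i)) with hYdef
  have hYball : ∀ᶠ i in U, ∀ t ∈ Icc a b, Y i t ∈ Metric.closedBall (0 : F) (R + ε) := by
    filter_upwards [hbd] with i hi t ht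
    exact hi _ ⟨le_min ht.1 (hσ i).1, min_le_right _ _⟩
  have hYmod : ∀ᶠ i in U, ∀ s ∈ Icc a b, ∀ t ∈ Icc a b, ‖Y i t - Y i s‖ ≤
      C * (eVariationOn x (uIcc s t)).toReal +
        C * (eVariationOn (fun t => x' i t - x t) (Icc a b)).toReal := by
    filter_upwards [hbd] with i hi s hs t ht
    exact (hz' i).norm_stopped_sub_le hx (hd i) hC (fun r hr => hGC _ (hi r hr)) hs ht
  have hω : ∀ s ∈ Icc a b, Tendsto (fun t => C * (eVariationOn x (uIcc s t)).toReal)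
      (𝓝[Icc a b] s) (𝓝 0) := by
    intro s hs
    simpa using (tendsto_eVariationOn_uIcc hx hxc hs).const_mul C
  have hd1 : Tendsto (fun i => C * (eVariationOn (fun t => x' i t - x t) (Icc a b)).toReal) U
      (𝓝 0) := by
    simpa using hd0.const_mul C
  -- The image ultrafilter lives on a compact ball, so pointwise limits exist without extracting
  -- subsequences.
  have hlim : ∀ t, ∃ l, t ∈ Icc a b → l ∈ Metric.closedBall (0 : F) (R + ε) ∧
      Tendsto (fun i => Y i t) U (𝓝 l) := by
    intro t
    by_cases ht : t ∈ Icc a b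
    · obtain ⟨l, hl, hl'⟩ := hball.ultrafilter_le_nhds (U.map fun i => Y i t)
        (le_principal_iff.2 (hYball.mono fun i hi => hi t ht))
      exact ⟨l, fun _ => ⟨hl, hl'⟩⟩
    · exact ⟨0, fun h => absurd h ht⟩
  choose y hy using hlim
  have hyt : ∀ t ∈ Icc a b, Tendsto (fun i => Y i t) U (𝓝 (y t)) := fun t ht => (hy t ht).2
  have hyc : ContinuousOn y (Icc a b) := continuousOn_of_asymptotic hω hd1 hYmod hyt
  have hunif : TendstoUniformlyOn Y y U (Icc a b) :=
    tendstoUniformlyOn_of_asymptotic isCompact_Icc hω hd1 hYmod hyt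
  have hamem : a ∈ Icc a b := left_mem_Icc.2 hab
  have hya : y a = z a := by
    refine tendsto_nhds_unique (hyt a hamem) (h0.congr fun i => ?_)
    rw [hYdef]
    simp only [min_eq_left (hσ i).1]
  obtain ⟨s, hs, hsl⟩ := (isCompact_Icc (a := a) (b := b)).ultrafilter_le_nhds (U.map σ)
    (le_principal_iff.2 (Eventually.of_forall (f := (U : Filter ι)) hσ))
  have hσs : Tendsto σ U (𝓝 s) := hsl
  have hGY : TendstoUniformlyOn (fun i t => G (Y i t)) (fun t => G (y t)) U (Icc a b) :=
    (hball.uniformContinuousOn_of_continuous hG.continuousOn).comp_tendstoUniformlyOn_eventually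
      hYball (fun t ht => (hy t ht).1) hunif
  -- For `r < s` the stopping times eventually exceed `r`, so the stopped solutions are genuine
  -- solutions on `[a, r]` and the equation passes to the limit.
  have hsol : ∀ r ∈ Ioo a s, SolvesCDE G x a r y := by
    intro r hr
    have hrb : r ≤ b := hr.2.le.trans hs.2
    refine ⟨hyc.mono (Icc_subset_Icc_right hrb), fun t ht => ?_⟩
    have htb : t ≤ b := ht.2.trans hrb
    have hsub : Icc a t ⊆ Icc a b := Icc_subset_Icc_right htb
    have hts : ∀ᶠ i in U, t < σ i := hσs.eventually (lt_mem_nhds (ht.2.trans_lt hr.2))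
    refine tendsto_rsSum_of_limit (U := (U : Filter ι)) (x' := x')
      (A' := fun i t => G (Y i t)) (I' := fun i => Y i t - Y i a) (hx.mono hsub)
      (fun i => (hd i).mono hsub) ?_ hC ?_ (hGY.mono hsub) ?_
      ((hyt t ⟨ht.1.le, htb⟩).sub (hyt a hamem))
    · refine squeeze_zero (fun _ => ENNReal.toReal_nonneg) (fun i => ?_) hd0
      exact ENNReal.toReal_mono (hd i) (eVariationOn.mono _ hsub)
    · exact hYball.mono fun i hi s hs => hGC _ (hi s (hsub hs))
    · filter_upwards [hts] with i hi
      have e : ∀ s ∈ Icc a t, Y i s = z' i s := fun s hs => by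
        rw [hYdef]
        simp only [min_eq_left (hs.2.trans hi.le)]
      rw [e t ⟨ht.1.le, le_rfl⟩, e a ⟨le_rfl, ht.1.le⟩]
      refine ((hz' i).2 t ⟨ht.1, htb⟩).congr' ?_
      filter_upwards [eventually_isTaggedPartition a t one_pos] with P hP
      refine Finset.sum_congr rfl fun j hj => ?_
      simp only [e _ (hP.tag_mem (Finset.mem_range.1 hj))]
  -- Uniqueness gives equality on `[a, s)`, and continuity extends it to `s`. If `s = a`, it is the
  -- initial condition.
  have hyz : y s = z s := by
    rcases hs.1.eq_or_lt with h | h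
    · rw [← h, hya]
    · have hsub : Ico a s ⊆ Icc a b := fun t ht => ⟨ht.1, ht.2.le.trans hs.2⟩
      have heq : EqOn y z (Ico a s) := by
        intro t ht
        obtain ⟨r, h1, h2⟩ := exists_between ht.2
        exact huniq r ⟨ht.1.trans_lt h1, h2.le.trans hs.2⟩ y (hsol r ⟨ht.1.trans_lt h1, h2⟩) hya
          ⟨ht.1, h1.le⟩
      refine heq.of_subset_closure (hyc.mono (Icc_subset_Icc_right hs.2))
        (hz.mono (Icc_subset_Icc_right hs.2)) Ico_subset_Icc_self ?_ (right_mem_Icc.2 hs.1)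
      rw [closure_Ico h.ne]
  have hσw : Tendsto σ U (𝓝[Icc a b] s) :=
    tendsto_nhdsWithin_iff.2 ⟨hσs, Eventually.of_forall hσ⟩
  have l1 : Tendsto (fun i => dist (y (σ i)) (z (σ i))) U (𝓝 0) := by
    have := ((hyc s hs).tendsto.comp hσw).dist ((hz s hs).tendsto.comp hσw)
    rwa [hyz, dist_self] at this
  have l2 := Metric.tendstoUniformlyOn_iff.1 hunif (ε / 2) (half_pos hε)
  -- At `σ i` the stopped solution is within `ε / 2` of `y`, which is within `ε / 2` of `z`, yet its
  -- distance to `z` is exactly `ε`.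
  obtain ⟨i, h1, h2, h3⟩ :=
    (hgood.and ((l1.eventually (gt_mem_nhds (half_pos hε))).and l2)).exists
  have h4 := h3 (σ i) (hσ i)
  have h5 : Y i (σ i) = z' i (σ i) := by
    rw [hYdef]
    simp only [min_self]
  rw [h5] at h4
  have h6 : dist (z' i (σ i)) (z (σ i)) = ε := h1.1
  have := dist_triangle_left (z' i (σ i)) (z (σ i)) (y (σ i))
  linarith

end Stability

/-! ### Time-augmented paths -/

/-- The embedding `x ↦ (x, 0)`. -/
noncomputable def appendZero (v : ℕ) :
    EuclideanSpace ℝ (Fin v) →ₗᵢ[ℝ] EuclideanSpace ℝ (Fin (v + 1)) where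
  toFun x := WithLp.toLp 2 (Fin.snoc (α := fun _ => ℝ) x.ofLp 0)
  map_add' x y := by
    ext i
    refine Fin.lastCases ?_ (fun i => ?_) i <;> simp
  map_smul' c x := by
    ext i
    refine Fin.lastCases ?_ (fun i => ?_) i <;> simp
  norm_map' x := by
    simp [EuclideanSpace.norm_eq, Fin.sum_univ_castSucc]

theorem appendZero_apply {v : ℕ} (x : EuclideanSpace ℝ (Fin v)) :
    appendZero v x = WithLp.toLp 2 (Fin.snoc (α := fun _ => ℝ) x.ofLp 0) := rfl

namespace BVPath

variable {τ T : ℝ} (h : τ ≤ T) {v : ℕ}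

theorem augment_eq (X : BVPath τ T v) (t : ℝ) :
    X.augment h t = appendZero v (IccExtend h X.toContinuousMap t) +
      t • EuclideanSpace.single (Fin.last v) (1 : ℝ) := by
  ext i
  refine Fin.lastCases ?_ (fun i => ?_) i <;> simp [augment, appendZero_apply]

theorem augment_last (X : BVPath τ T v) (t : ℝ) : X.augment h t (Fin.last v) = t := by
  simp [augment]

theorem continuous_augment (X : BVPath τ T v) : Continuous (X.augment h) := by
  rw [funext (X.augment_eq h)]
  exact ((appendZero v).continuous.comp X.toContinuousMap.continuous.Icc_extend').add
    (continuous_id.smul continuous_const)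

/-- The time components cancel, so convergence in the norm of `BVPath` controls the augmented paths
both uniformly and in variation. -/
theorem augment_sub (X Y : BVPath τ T v) (t : ℝ) :
    X.augment h t - Y.augment h t = appendZero v (IccExtend h (X - Y).toContinuousMap t) := by
  rw [augment_eq, augment_eq, add_sub_add_right_eq_sub, ← map_sub]
  rfl

/-- The embedding is 1-Lipschitz, and the extension is a composition with the monotone map
`projIcc`; neither increases variation. -/
theorem eVariationOn_appendZero_le (X : BVPath τ T v) (s : Set ℝ) :
    eVariationOn (fun t => appendZero v (IccExtend h X.toContinuousMap t)) s ≤ X.eVar := by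
  have h1 := (appendZero v).lipschitz.lipschitzOnWith.comp_eVariationOn_le
    (mapsTo_univ (IccExtend h X.toContinuousMap) s)
  rw [ENNReal.coe_one, one_mul] at h1
  exact h1.trans (eVariationOn.comp_le_of_monotoneOn X.toContinuousMap (projIcc τ T h)
    ((monotone_projIcc h).monotoneOn s) (mapsTo_univ _ _))

theorem boundedVariationOn_augment (X : BVPath τ T v) (a b : ℝ) :
    BoundedVariationOn (X.augment h) (Icc a b) := by
  rw [funext (X.augment_eq h)]
  have h2 : BoundedVariationOn
      (fun t : ℝ => t • EuclideanSpace.single (Fin.last v) (1 : ℝ)) (Icc a b) :=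
    (ContinuousLinearMap.lipschitz ((ContinuousLinearMap.id ℝ ℝ).smulRight
      (EuclideanSpace.single (Fin.last v) (1 : ℝ)))).comp_boundedVariationOn
      (BoundedVariationOn.id_Icc a b)
  exact ne_top_of_le_ne_top (ENNReal.add_ne_top.2
    ⟨ne_top_of_le_ne_top X.eVar_ne_top (X.eVariationOn_appendZero_le h (Icc a b)), h2⟩)
    (eVariationOn_add_le' _ _ _)

theorem eVariationOn_augment_sub_le (X Y : BVPath τ T v) (s : Set ℝ) :
    eVariationOn (fun t => X.augment h t - Y.augment h t) s ≤ (X - Y).eVar := by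
  simp_rw [augment_sub]
  exact eVariationOn_appendZero_le h (X - Y) s

theorem norm_augment_sub_le (X Y : BVPath τ T v) (t : ℝ) :
    ‖X.augment h t - Y.augment h t‖ ≤ ‖X - Y‖ := by
  rw [augment_sub, LinearIsometry.norm_map, norm_def]
  exact ((X - Y).toContinuousMap.norm_coe_le_norm _).trans
    (le_add_of_nonneg_right ENNReal.toReal_nonneg)

theorem toReal_eVar_le (X : BVPath τ T v) : X.eVar.toReal ≤ ‖X‖ := by
  rw [norm_def]
  exact le_add_of_nonneg_left (norm_nonneg _)

end BVPath

theorem isCDESolution_iff {w d : ℕ} {f : EuclideanSpace ℝ (Fin w) → Matrix (Fin w) (Fin d) ℝ}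
    {X : ℝ → EuclideanSpace ℝ (Fin d)} {ζ₀ : EuclideanSpace ℝ (Fin w)} {τ σ : ℝ}
    {z : ℝ → EuclideanSpace ℝ (Fin w)} :
    IsCDESolution f X ζ₀ τ σ z ↔
      SolvesCDE (fun p => matrixCLM w d (f p)) X τ σ z ∧ z τ = ζ₀ := by
  simp only [IsCDESolution, SolvesCDE, hasRSIntegral_iff_tendsto]
  tauto

theorem continuous_terminal_value {τ T : ℝ} (h : τ ≤ T) {v w : ℕ}
    {f : EuclideanSpace ℝ (Fin w) → Matrix (Fin w) (Fin (v + 1)) ℝ}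
    {ζ : EuclideanSpace ℝ (Fin (v + 1)) → EuclideanSpace ℝ (Fin w)}
    {z : BVPath τ T v → ℝ → EuclideanSpace ℝ (Fin w)} (hf : Continuous f) (hζ : Continuous ζ)
    (hz : ∀ X : BVPath τ T v,
      IsUniqueCDESolution f (X.augment h) (ζ (X.augment h τ)) τ T (z X)) :
    Continuous fun X => z X T := by
  simp only [IsUniqueCDESolution, isCDESolution_iff] at hz
  rw [continuous_iff_continuousAt]
  intro X
  rw [ContinuousAt, tendsto_iff_ultrafilter]
  intro U hU
  have hn : Tendsto (fun Y : BVPath τ T v => ‖Y - X‖) U (𝓝 0) :=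
    (tendsto_iff_norm_sub_tendsto_zero.1 (tendsto_id (x := 𝓝 X))).mono_left hU
  refine tendsto_of_unique_solution (U := U) (x := X.augment h)
    (x' := fun Y : BVPath τ T v => Y.augment h) (z := z X) (z' := z)
    ((continuous_matrixCLM w (v + 1)).comp hf) h (X.boundedVariationOn_augment h _ _)
    (X.continuous_augment h).continuousOn
    (fun Y => ne_top_of_le_ne_top (Y - X).eVar_ne_top (Y.eVariationOn_augment_sub_le h X _)) ?_
    (hz X).1.1.1 (fun Y => (hz Y).1.1) ?_ ?_
  · refine squeeze_zero (fun _ => ENNReal.toReal_nonneg) (fun Y => ?_) hn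
    exact (ENNReal.toReal_mono (Y - X).eVar_ne_top (Y.eVariationOn_augment_sub_le h X _)).trans
      (Y - X).toReal_eVar_le
  · exact fun σ hσ y hy hy0 => (hz X).2 σ hσ y ⟨hy, hy0.trans (hz X).1.2⟩
  · simp only [(hz _).1.2]
    refine (hζ.tendsto _).comp ?_
    rw [tendsto_iff_norm_sub_tendsto_zero]
    exact squeeze_zero (fun _ => norm_nonneg _) (fun Y => Y.norm_augment_sub_le h X τ) hn

theorem continuous_of_mem_cdeMaps {τ T : ℝ} (h : τ ≤ T) {v u : ℕ} {K : Set (BVPath τ T v)}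
    {Φ : K → EuclideanSpace ℝ (Fin u)} (hΦ : Φ ∈ cdeMaps h u K) : Continuous Φ := by
  obtain ⟨w, f, ζ, ℓ, z, hf, hζ, hz, rfl⟩ := hΦ
  exact (LinearMap.continuous_of_finiteDimensional ℓ).comp
    ((continuous_terminal_value h hf hζ hz).comp continuous_subtype_val)

/-! ### Exponentials of time integrals along a path, as solutions of a CDE -/

theorem tendsto_rsSum_apply_iff {ι E : Type*} [Fintype ι] [NormedAddCommGroup E]
    [NormedSpace ℝ E] {A : ℝ → E →L[ℝ] EuclideanSpace ℝ ι} {X : ℝ → E} {a b : ℝ}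
    {I : EuclideanSpace ℝ ι} :
    Tendsto (rsSum A X) (rsFilter a b) (𝓝 I) ↔
      ∀ k, Tendsto (rsSum (fun s => (EuclideanSpace.proj k : EuclideanSpace ℝ ι →L[ℝ] ℝ) ∘L A s) X)
        (rsFilter a b) (𝓝 (I k)) := by
  rw [(EuclideanSpace.equiv ι ℝ).toHomeomorph.isInducing.tendsto_nhds_iff, tendsto_pi_nhds]
  refine forall_congr' fun k => ?_
  have e : rsSum (fun s => (EuclideanSpace.proj k : EuclideanSpace ℝ ι →L[ℝ] ℝ) ∘L A s) X =
      fun P => rsSum A X P k := by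
    ext P
    exact (map_sum (EuclideanSpace.proj k : EuclideanSpace ℝ ι →L[ℝ] ℝ) _ _).symm
  rw [e]
  rfl

theorem tendsto_rsSum_const {E F : Type*} [NormedAddCommGroup E] [NormedSpace ℝ E]
    [NormedAddCommGroup F] [NormedSpace ℝ F] (L : E →L[ℝ] F) (X : ℝ → E) (a b : ℝ) :
    Tendsto (rsSum (fun _ => L) X) (rsFilter a b) (𝓝 (L (X b) - L (X a))) :=
  tendsto_rsSum_of_increment (Z := fun t => L (X t)) fun ε hε =>
    ⟨1, one_pos, fun p ξ q _ h1 h2 _ _ => by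
      rw [map_sub, sub_self, norm_zero]
      exact mul_nonneg hε.le (by linarith)⟩

/-- Since `L` reads off the time coordinate, `L (X q - X p) = q - p` and the sums are ordinary
Riemann sums; uniform continuity of `φ` bounds the error on each piece. -/
theorem tendsto_rsSum_integral {E : Type*} [NormedAddCommGroup E] [NormedSpace ℝ E]
    {φ : ℝ → ℝ} {a b : ℝ} (hφ : ContinuousOn φ (Icc a b)) {X : ℝ → E}
    {L : E →L[ℝ] ℝ} (hL : ∀ t, L (X t) = t) :
    Tendsto (rsSum (fun s => φ s • L) X) (rsFilter a b) (𝓝 (∫ s in a..b, φ s)) := by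
  have hint : ∀ p q, a ≤ p → p ≤ q → q ≤ b → IntervalIntegrable φ MeasureTheory.volume p q :=
    fun p q h1 h2 h3 => (hφ.mono (Icc_subset_Icc h1 h3)).intervalIntegrable_of_Icc h2
  have := tendsto_rsSum_of_increment (A := fun s => φ s • L) (X := X)
    (Z := fun t => ∫ s in a..t, φ s) (a := a) (b := b) fun ε hε => by
      obtain ⟨δ, hδ, hu⟩ := Metric.uniformContinuousOn_iff.1
        (isCompact_Icc.uniformContinuousOn_of_continuous hφ) ε hε
      refine ⟨δ, hδ, fun p ξ q h1 h2 h3 h4 h5 => ?_⟩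
      have hpq := h2.trans h3
      rw [intervalIntegral.integral_interval_sub_left (hint a q le_rfl (h1.trans hpq) h4)
        (hint a p le_rfl h1 (hpq.trans h4))]
      have e : (φ ξ • L) (X q - X p) = ∫ _ in p..q, φ ξ := by
        rw [intervalIntegral.integral_const, smul_apply, map_sub, hL, hL,
          smul_eq_mul, smul_eq_mul, mul_comm]
      rw [e, ← intervalIntegral.integral_sub intervalIntegrable_const (hint p q h1 hpq h4),
        ← abs_of_nonneg (sub_nonneg.2 hpq)]
      refine intervalIntegral.norm_integral_le_of_norm_le_const fun s hs => ?_
      rw [uIoc_of_le hpq] at hs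
      rw [← dist_eq_norm]
      refine (hu ξ ⟨h1.trans h2, h3.trans h4⟩ s ⟨h1.trans hs.1.le, hs.2.trans h4⟩ ?_).le
      rw [Real.dist_eq, abs_sub_lt_iff]
      constructor <;> linarith [hs.1, hs.2]
  simpa using this

theorem hasDerivAt_exp_integral {k : ℝ → ℝ} (hk : Continuous k) (a t : ℝ) :
    HasDerivAt (fun t => Real.exp (∫ s in a..t, k s)) (Real.exp (∫ s in a..t, k s) * k t) t :=
  (hk.integral_hasStrictDerivAt a t).hasDerivAt.exp

/-- The linear integral equation `q t = 1 + ∫ₐᵗ q k` has only the exponential solution. -/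
theorem eq_exp_integral_of_integral_eq {k q : ℝ → ℝ} (hk : Continuous k) {a b : ℝ}
    (hq : ContinuousOn q (Icc a b)) (h : ∀ t ∈ Icc a b, q t = 1 + ∫ s in a..t, q s * k s) :
    ∀ t ∈ Icc a b, q t = Real.exp (∫ s in a..t, k s) := by
  intro t ht
  have hab : a ≤ b := ht.1.trans ht.2
  -- Extending `q` continuously to the whole line makes its indefinite integral differentiable
  -- everywhere, including at the endpoints.
  set r : ℝ → ℝ := IccExtend hab (domRestrict (Icc a b) q) with hr
  have hrc : Continuous r := (continuousOn_iff_continuous_domRestrict.1 hq).Icc_extend'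
  have hrq : ∀ s ∈ Icc a b, r s = q s := fun s hs => by
    rw [hr, IccExtend_of_mem _ _ hs, domRestrict_apply]
  set Y : ℝ → ℝ := fun t => 1 + ∫ s in a..t, r s * k s with hY
  have hYq : ∀ s ∈ Icc a b, Y s = q s := by
    intro s hs
    rw [h s hs]
    refine congrArg (1 + ·) ?_
    refine intervalIntegral.integral_congr fun x hx => ?_
    rw [uIcc_of_le hs.1] at hx
    simp only [hrq x ⟨hx.1, hx.2.trans hs.2⟩]
  have hYd : ∀ s, HasDerivAt Y (r s * k s) s := fun s =>
    ((hrc.mul hk).integral_hasStrictDerivAt a s).hasDerivAt.const_add 1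
  have hk' : Continuous fun s => -k s := hk.neg
  have hYe : ∀ s, HasDerivAt (fun t => Y t * Real.exp (∫ s in a..t, -k s))
      (r s * k s * Real.exp (∫ s in a..s, -k s) +
        Y s * (Real.exp (∫ s in a..s, -k s) * -k s)) s :=
    fun s => (hYd s).mul (hasDerivAt_exp_integral hk' a s)
  -- The integrating factor `exp (-∫ k)`: on `[a, b)` both `r` and `Y` equal `q`, so the two terms
  -- of the derivative cancel.
  have hconst := constant_of_has_deriv_right_zero (a := a) (b := b)
    (f := fun t => Y t * Real.exp (∫ s in a..t, -k s))
    (fun s _ => (hYe s).continuousAt.continuousWithinAt) fun s hs => by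
      have := (hYe s).hasDerivWithinAt (s := Ici s)
      rw [hrq s ⟨hs.1, hs.2.le⟩, hYq s ⟨hs.1, hs.2.le⟩] at this
      convert this using 1
      ring
  have := hconst t ht
  simp only [hY, intervalIntegral.integral_same, add_zero, Real.exp_zero, mul_one] at this
  change Y t * _ = 1 at this
  rw [hYq t ht, intervalIntegral.integral_neg, Real.exp_neg, ← div_eq_mul_inv,
    div_eq_one_iff_eq (Real.exp_pos _).ne'] at this
  exact this

section ExpSystem

variable {n m : ℕ}

/-- The projection of `ℝⁿ⁺ᵐ` to the first `n` coordinates. -/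
noncomputable def headCoords (n m : ℕ) (p : EuclideanSpace ℝ (Fin (n + m))) :
    EuclideanSpace ℝ (Fin n) :=
  WithLp.toLp 2 fun i => p (Fin.castAdd m i)

theorem continuous_headCoords : Continuous (headCoords n m) := by
  unfold headCoords
  fun_prop

/-- The vector field whose solution carries the driving path and, for every `j`, the exponential
of the time integral of `g j` along the path. -/
noncomputable def expField {v : ℕ} (g : Fin m → C(EuclideanSpace ℝ (Fin (v + 1)), ℝ))
    (p : EuclideanSpace ℝ (Fin (v + 1 + m))) : Matrix (Fin (v + 1 + m)) (Fin (v + 1)) ℝ :=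
  Matrix.of (Fin.append (fun i : Fin (v + 1) => Pi.single i (1 : ℝ))
    fun j => Pi.single (Fin.last v) (p (Fin.natAdd (v + 1) j) * g j (headCoords (v + 1) m p)))

theorem continuous_expField {v : ℕ} (g : Fin m → C(EuclideanSpace ℝ (Fin (v + 1)), ℝ)) :
    Continuous (expField g) := by
  refine continuous_pi fun k => ?_
  refine Fin.addCases (fun i => ?_) (fun j => ?_) k
  · have e : (fun p => expField g p (Fin.castAdd m i)) = fun _ => Pi.single i (1 : ℝ) := by
      ext p l
      simp [expField]
    rw [e]
    exact continuous_const
  · have e : (fun p => expField g p (Fin.natAdd (v + 1) j)) = fun p => Pi.single (Fin.last v)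
        (p (Fin.natAdd (v + 1) j) * g j (headCoords (v + 1) m p)) := by
      ext p l
      simp [expField]
    rw [e]
    refine (continuous_single (A := fun _ : Fin (v + 1) => ℝ) (Fin.last v)).comp
      (Continuous.mul (by fun_prop) ?_)
    exact (g j).continuous.comp continuous_headCoords

theorem proj_castAdd_expField {v : ℕ} (g : Fin m → C(EuclideanSpace ℝ (Fin (v + 1)), ℝ))
    (p : EuclideanSpace ℝ (Fin (v + 1 + m))) (i : Fin (v + 1)) :
    (EuclideanSpace.proj (Fin.castAdd m i) : EuclideanSpace ℝ (Fin (v + 1 + m)) →L[ℝ] ℝ) ∘L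
      matrixCLM _ _ (expField g p) = EuclideanSpace.proj i := by
  ext x
  simp [matrixCLM_apply, expField, Matrix.mulVec, dotProduct, Pi.single_apply]

theorem proj_natAdd_expField {v : ℕ} (g : Fin m → C(EuclideanSpace ℝ (Fin (v + 1)), ℝ))
    (p : EuclideanSpace ℝ (Fin (v + 1 + m))) (j : Fin m) :
    (EuclideanSpace.proj (Fin.natAdd (v + 1) j) : EuclideanSpace ℝ (Fin (v + 1 + m)) →L[ℝ] ℝ) ∘L
      matrixCLM _ _ (expField g p) =
      (p (Fin.natAdd (v + 1) j) * g j (headCoords (v + 1) m p)) •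
        EuclideanSpace.proj (Fin.last v) := by
  ext x
  simp [matrixCLM_apply, expField, Matrix.mulVec, dotProduct, Pi.single_apply]

/-- The initial condition of the system `expField`. -/
noncomputable def expInit (m : ℕ) {v : ℕ} (x : EuclideanSpace ℝ (Fin (v + 1))) :
    EuclideanSpace ℝ (Fin (v + 1 + m)) :=
  WithLp.toLp 2 (Fin.append x.ofLp fun _ => (1 : ℝ))

theorem continuous_expInit {v : ℕ} : Continuous (expInit m (v := v)) := by
  refine (PiLp.continuous_toLp 2 _).comp (continuous_pi fun k => ?_)
  refine Fin.addCases (fun i => ?_) (fun j => ?_) k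
  · simp only [Fin.append_left]
    fun_prop
  · simp only [Fin.append_right]
    exact continuous_const

/-- The exponential of the integral of `g` along the time-augmented path, up to time `t`. -/
noncomputable def pathExp {τ T : ℝ} (h : τ ≤ T) {v : ℕ}
    (g : C(EuclideanSpace ℝ (Fin (v + 1)), ℝ)) (X : BVPath τ T v) (t : ℝ) : ℝ :=
  Real.exp (∫ s in τ..t, g (X.augment h s))

/-- The solution of the system `expField`. -/
noncomputable def expSolution {τ T : ℝ} (h : τ ≤ T) {v : ℕ}
    (g : Fin m → C(EuclideanSpace ℝ (Fin (v + 1)), ℝ)) (X : BVPath τ T v) (t : ℝ) :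
    EuclideanSpace ℝ (Fin (v + 1 + m)) :=
  WithLp.toLp 2 (Fin.append (X.augment h t).ofLp fun j => pathExp h (g j) X t)

/-- The system is triangular. The first block has constant coefficients, so its integral telescopes
and forces the head of any solution to be `X`. Each remaining coordinate then satisfies a scalar
linear integral equation with continuous coefficient `g j (X_s)`. -/
theorem isUniqueCDESolution_expSolution {τ T : ℝ} (h : τ ≤ T) {v : ℕ}
    (g : Fin m → C(EuclideanSpace ℝ (Fin (v + 1)), ℝ)) (X : BVPath τ T v) :
    IsUniqueCDESolution (expField g) (X.augment h) (expInit m (X.augment h τ)) τ T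
      (expSolution h g X) := by
  have hX := X.continuous_augment h
  have hk : ∀ j, Continuous fun s => g j (X.augment h s) := fun j => (g j).continuous.comp hX
  have hL : ∀ t, (EuclideanSpace.proj (Fin.last v) : EuclideanSpace ℝ (Fin (v + 1)) →L[ℝ] ℝ)
      (X.augment h t) = t := X.augment_last h
  have hd : ∀ j t, HasDerivAt (pathExp h (g j) X)
      (pathExp h (g j) X t * g j (X.augment h t)) t := fun j t =>
    hasDerivAt_exp_integral (hk j) τ t
  have hc : ∀ j, Continuous (pathExp h (g j) X) := fun j =>
    continuous_iff_continuousAt.2 fun t => (hd j t).continuousAt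
  have hsc : Continuous (expSolution h g X) := by
    refine (PiLp.continuous_toLp 2 _).comp (continuous_pi fun k => ?_)
    refine Fin.addCases (fun i => ?_) (fun j => ?_) k
    · simp only [Fin.append_left]
      fun_prop
    · simp only [Fin.append_right]
      exact hc j
  have hhead : ∀ t, headCoords (v + 1) m (expSolution h g X t) = X.augment h t := by
    intro t
    ext i
    simp [headCoords, expSolution]
  simp only [IsUniqueCDESolution, isCDESolution_iff]
  refine ⟨⟨⟨hsc.continuousOn, fun t ht => ?_⟩, ?_⟩, ?_⟩
  · rw [tendsto_rsSum_apply_iff]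
    intro k
    refine Fin.addCases (fun i => ?_) (fun j => ?_) k
    · simp only [proj_castAdd_expField]
      simpa [expSolution] using tendsto_rsSum_const
        (EuclideanSpace.proj i : EuclideanSpace ℝ (Fin (v + 1)) →L[ℝ] ℝ) (X.augment h) τ t
    · simp only [proj_natAdd_expField, hhead]
      have hφ : Continuous fun s => expSolution h g X s (Fin.natAdd (v + 1) j) *
          g j (X.augment h s) := by
        simp only [expSolution, Fin.append_right]
        exact (hc j).mul (hk j)
      convert tendsto_rsSum_integral (hφ.continuousOn (s := Icc τ t)) hL using 2
      simp only [expSolution, Fin.append_right, PiLp.sub_apply]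
      exact (intervalIntegral.integral_eq_sub_of_hasDerivAt (fun s _ => hd j s)
        (((hc j).mul (hk j)).intervalIntegrable _ _)).symm
  · simp only [expSolution, expInit, pathExp, intervalIntegral.integral_same, Real.exp_zero]
  · rintro σ hσ y ⟨hy, hy0⟩
    have hcoord : ∀ t ∈ Icc τ σ, ∀ k, Tendsto (rsSum (fun s => (EuclideanSpace.proj k :
        EuclideanSpace ℝ (Fin (v + 1 + m)) →L[ℝ] ℝ) ∘L matrixCLM _ _ (expField g (y s)))
        (X.augment h)) (rsFilter τ t) (𝓝 ((y t - y τ) k)) := fun t ht =>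
      tendsto_rsSum_apply_iff.1 (hy.tendsto ht)
    have h1 : ∀ t ∈ Icc τ σ, ∀ i, y t (Fin.castAdd m i) = X.augment h t i := by
      intro t ht i
      have hb := hcoord t ht (Fin.castAdd m i)
      simp only [proj_castAdd_expField] at hb
      have := rsFilter_neBot ht.1
      have he := tendsto_nhds_unique hb (tendsto_rsSum_const
        (EuclideanSpace.proj i : EuclideanSpace ℝ (Fin (v + 1)) →L[ℝ] ℝ) (X.augment h) τ t)
      rw [hy0] at he
      simpa [expInit] using he
    have hheady : ∀ t ∈ Icc τ σ, headCoords (v + 1) m (y t) = X.augment h t := by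
      intro t ht
      ext i
      exact h1 t ht i
    have hyj : ∀ j : Fin m, ContinuousOn (fun t => y t (Fin.natAdd (v + 1) j)) (Icc τ σ) :=
      fun j => (EuclideanSpace.proj (Fin.natAdd (v + 1) j) :
        EuclideanSpace ℝ (Fin (v + 1 + m)) →L[ℝ] ℝ).continuous.comp_continuousOn hy.1
    have h2 : ∀ j, ∀ t ∈ Icc τ σ, y t (Fin.natAdd (v + 1) j) =
        1 + ∫ s in τ..t, y s (Fin.natAdd (v + 1) j) * g j (X.augment h s) := by
      intro j t ht
      have hb := hcoord t ht (Fin.natAdd (v + 1) j)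
      simp only [proj_natAdd_expField] at hb
      have := rsFilter_neBot ht.1
      have hφ : ContinuousOn (fun s => y s (Fin.natAdd (v + 1) j) *
          g j (headCoords (v + 1) m (y s))) (Icc τ t) :=
        ((hyj j).mul ((g j).continuous.comp continuous_headCoords |>.comp_continuousOn hy.1)).mono
          (Icc_subset_Icc_right ht.2)
      have he := tendsto_nhds_unique hb (tendsto_rsSum_integral hφ hL)
      rw [hy0, PiLp.sub_apply, sub_eq_iff_eq_add'] at he
      rw [he]
      congr 1
      · simp [expInit]
      · refine intervalIntegral.integral_congr fun s hs => ?_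
        rw [uIcc_of_le ht.1] at hs
        simp only [hheady s ⟨hs.1, hs.2.trans ht.2⟩]
    intro t ht
    ext k
    refine Fin.addCases (fun i => ?_) (fun j => ?_) k
    · simpa [expSolution] using h1 t ht i
    · simpa [expSolution, pathExp] using eq_exp_integral_of_integral_eq (hk j) (hyj j) (h2 j) t ht

/-- All exponentials sit in one hidden state, so a linear readout produces any combination of them
with vector coefficients. -/
theorem sum_pathExp_smul_mem_cdeMaps {τ T : ℝ} (h : τ ≤ T) {v u : ℕ} (K : Set (BVPath τ T v))
    (g : Fin m → C(EuclideanSpace ℝ (Fin (v + 1)), ℝ)) (c : Fin m → EuclideanSpace ℝ (Fin u)) :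
    (fun X : K => ∑ j, pathExp h (g j) X.1 T • c j) ∈ cdeMaps h u K := by
  refine ⟨v + 1 + m, expField g, expInit m,
    ∑ j, ((EuclideanSpace.proj (Fin.natAdd (v + 1) j) :
      EuclideanSpace ℝ (Fin (v + 1 + m)) →L[ℝ] ℝ).toLinearMap).smulRight (c j),
    expSolution h g, continuous_expField g, continuous_expInit,
    isUniqueCDESolution_expSolution h g, ?_⟩
  ext1 X
  simp [expSolution]

end ExpSystem

/-! ### Density -/

section Density

variable {τ T : ℝ} (h : τ ≤ T) {v : ℕ} (K : Set (BVPath τ T v))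

theorem continuous_pathExp (g : C(EuclideanSpace ℝ (Fin (v + 1)), ℝ)) :
    Continuous fun X : K => pathExp h g X.1 T := by
  have := continuous_of_mem_cdeMaps h (sum_pathExp_smul_mem_cdeMaps h K (fun _ : Fin 1 => g)
    fun _ => EuclideanSpace.single (0 : Fin 1) (1 : ℝ))
  simpa [Function.comp_def] using
    (EuclideanSpace.proj (0 : Fin 1) : EuclideanSpace ℝ (Fin 1) →L[ℝ] ℝ).continuous.comp this

/-- The map `X ↦ exp (∫ g (X_s) ds)` on `K`. -/
noncomputable def pathExpMap (g : C(EuclideanSpace ℝ (Fin (v + 1)), ℝ)) : C(K, ℝ) :=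
  ⟨fun X => pathExp h g X.1 T, continuous_pathExp h K g⟩

theorem pathExpMap_zero : pathExpMap h K 0 = 1 := by
  ext X
  simp [pathExpMap, pathExp]

theorem pathExpMap_add (g g' : C(EuclideanSpace ℝ (Fin (v + 1)), ℝ)) :
    pathExpMap h K (g + g') = pathExpMap h K g * pathExpMap h K g' := by
  ext X
  have hi : ∀ k : C(EuclideanSpace ℝ (Fin (v + 1)), ℝ), IntervalIntegrable
      (fun s => k (X.1.augment h s)) MeasureTheory.volume τ T := fun k =>
    (k.continuous.comp (X.1.continuous_augment h)).intervalIntegrable _ _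
  simp only [pathExpMap, pathExp, ContinuousMap.coe_mk, ContinuousMap.mul_apply,
    ContinuousMap.add_apply]
  rw [← Real.exp_add, intervalIntegral.integral_add (hi g) (hi g')]

/-- The multiplicative monoid of the maps `pathExpMap`. -/
noncomputable def pathExpSubmonoid : Submonoid C(K, ℝ) where
  carrier := range (pathExpMap h K)
  one_mem' := ⟨0, pathExpMap_zero h K⟩
  mul_mem' := by
    rintro _ _ ⟨g, rfl⟩ ⟨g', rfl⟩
    exact ⟨g + g', pathExpMap_add h K g g'⟩

/-- With `D = X - Y` and `g(p) = ⟨D(time of p), p⟩`, the two exponents differ by `∫ ‖D s‖² ds`,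
which vanishes only if the continuous function `D` is zero on `[τ, T]`. -/
theorem separatesPoints_adjoin_pathExp (hτT : τ < T) :
    (Algebra.adjoin ℝ (pathExpSubmonoid hτT.le K : Set C(K, ℝ))).SeparatesPoints := by
  intro X Y hXY
  have hXc := X.1.continuous_augment hτT.le
  have hYc := Y.1.continuous_augment hτT.le
  set D : ℝ → EuclideanSpace ℝ (Fin (v + 1)) := fun s =>
    X.1.augment hτT.le s - Y.1.augment hτT.le s with hD
  have hDc : Continuous D := hXc.sub hYc
  set g : C(EuclideanSpace ℝ (Fin (v + 1)), ℝ) :=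
    ⟨fun p => inner ℝ (D (p (Fin.last v))) p, (hDc.comp (by fun_prop)).inner continuous_id⟩ with hg
  refine ⟨_, ⟨_, Algebra.subset_adjoin ⟨g, rfl⟩, rfl⟩, fun heq => hXY (Subtype.ext ?_)⟩
  have hint : ∀ {x : ℝ → EuclideanSpace ℝ (Fin (v + 1))}, Continuous x →
      IntervalIntegrable (fun s => g (x s)) MeasureTheory.volume τ T :=
    fun hx => (g.continuous.comp hx).intervalIntegrable _ _
  have h1 : ∫ s in τ..T, g (X.1.augment hτT.le s) = ∫ s in τ..T, g (Y.1.augment hτT.le s) :=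
    Real.exp_injective heq
  rw [← sub_eq_zero, ← intervalIntegral.integral_sub
    (hint hXc) (hint hYc)] at h1
  have h2 : ∀ s, g (X.1.augment hτT.le s) - g (Y.1.augment hτT.le s) = ‖D s‖ ^ 2 := by
    intro s
    simp only [hg, ContinuousMap.coe_mk, BVPath.augment_last]
    rw [← inner_sub_right, ← real_inner_self_eq_norm_sq]
  simp_rw [h2] at h1
  have h3 : ∀ s ∈ Icc τ T, D s = 0 := by
    intro s hs
    by_contra hne
    refine h1.not_gt (intervalIntegral.integral_pos hτT (hDc.norm.pow 2).continuousOn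
      (fun _ _ => by positivity) ⟨s, hs, ?_⟩)
    have := norm_pos_iff.2 hne
    positivity
  refine Subtype.ext (ContinuousMap.ext fun s => sub_eq_zero.1 ?_)
  have h4 := h3 s s.2
  simp only [hD] at h4
  rw [BVPath.augment_sub, IccExtend_val] at h4
  exact (appendZero v).injective (h4.trans (map_zero _).symm)

/-- Stone–Weierstrass treats scalar functions; vector values follow by multiplying with a fixed
vector `e` and summing over the coordinates of `φ`. -/
theorem dense_cdeMaps (hτT : τ < T) (u : ℕ) [CompactSpace K] :
    Dense {φ : C(K, EuclideanSpace ℝ (Fin u)) | ⇑φ ∈ cdeMaps hτT.le u K} := by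
  set S : Set C(K, EuclideanSpace ℝ (Fin u)) := range fun p :
    C(EuclideanSpace ℝ (Fin (v + 1)), ℝ) × EuclideanSpace ℝ (Fin u) =>
      (ContinuousLinearMap.toSpanSingleton ℝ p.2).compLeftContinuous ℝ K (pathExpMap hτT.le K p.1)
  have hsub : (Submodule.span ℝ S : Set C(K, EuclideanSpace ℝ (Fin u))) ⊆
      {φ | ⇑φ ∈ cdeMaps hτT.le u K} := by
    intro φ hφ
    obtain ⟨m, r, p, rfl⟩ := (Submodule.mem_span_set' (R := ℝ)).1 hφ
    choose q hq using fun i => (p i).2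
    rw [mem_ofPred_eq]
    convert sum_pathExp_smul_mem_cdeMaps hτT.le K (fun j => (q j).1) (fun j => r j • (q j).2)
      using 1
    ext1 X
    simp only [← hq, ContinuousMap.coe_sum, ContinuousMap.coe_smul, Finset.sum_apply,
      Pi.smul_apply]
    refine Finset.sum_congr rfl fun j _ => ?_
    rw [smul_comm]
    rfl
  refine Dense.mono hsub fun φ => ?_
  have hcomp : ∀ (a : C(K, ℝ)) (e : EuclideanSpace ℝ (Fin u)),
      (ContinuousLinearMap.toSpanSingleton ℝ e).compLeftContinuous ℝ K a ∈
        (Submodule.span ℝ S).topologicalClosure := by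
    intro a e
    set L := (ContinuousLinearMap.toSpanSingleton ℝ e).compLeftContinuous ℝ K
    have ha : a ∈ closure (Algebra.adjoin ℝ (pathExpSubmonoid hτT.le K : Set C(K, ℝ)) :
        Set C(K, ℝ)) := by
      have := ContinuousMap.subalgebra_topologicalClosure_eq_top_of_separatesPoints _
        (separatesPoints_adjoin_pathExp K hτT)
      rw [← Subalgebra.topologicalClosure_coe, this]
      trivial
    refine map_mem_closure L.continuous ha fun b hb => ?_
    -- The exponentials are already closed under products, so the algebra they generate is merely
    -- their linear span.
    rw [SetLike.mem_coe, ← Subalgebra.mem_toSubmodule, Algebra.adjoin_eq_span,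
      Submonoid.closure_eq] at hb
    have hle : Submodule.span ℝ (pathExpSubmonoid hτT.le K : Set C(K, ℝ)) ≤
        (Submodule.span ℝ S).comap L.toLinearMap := by
      rw [Submodule.span_le]
      rintro _ ⟨g, rfl⟩
      exact Submodule.subset_span ⟨(g, e), rfl⟩
    exact hle hb
  have hφ : φ = ∑ i, (ContinuousLinearMap.toSpanSingleton ℝ
      (EuclideanSpace.single i (1 : ℝ))).compLeftContinuous ℝ K
        ((EuclideanSpace.proj i : EuclideanSpace ℝ (Fin u) →L[ℝ] ℝ).compLeftContinuous ℝ K φ) := by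
    ext X k
    simp [ContinuousMap.sum_apply, Pi.single_apply]
    rfl
  rw [hφ]
  exact Submodule.sum_mem (Submodule.span ℝ S).topologicalClosure fun i _ => hcomp _ _

end Density

theorem mainTheorem2 {τ T : ℝ} (hτT : τ < T) (v u : ℕ) (K : Set (BVPath τ T v))
    (hK : IsCompact K) :
    (∀ Φ ∈ cdeMaps hτT.le u K, Continuous Φ) ∧
      Dense {φ : C(K, EuclideanSpace ℝ (Fin u)) | ⇑φ ∈ cdeMaps hτT.le u K} := by
  have : CompactSpace K := isCompact_iff_compactSpace.1 hK
  exact ⟨fun Φ hΦ => continuous_of_mem_cdeMaps hτT.le hΦ, dense_cdeMaps K hτT u⟩
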